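/- **Conventions.** A $C$-relation on a set $M$ is a ternary relation such that, for all $x,y,z,w$: $C(x,y,z)\to C(x,z,y)$; $C(x,y,z)\to\neg C(y,x,z)$; $C(x,y,z)\to C(x,y,w)\vee C(w,y,z)$; and $x\neq y\to C(x,y,y)$. A $C$-structure is a structure in a countable first-order language with a distinguished symbol that is interpreted by a $C$-relation. It is $C$-minimal if, in every structure elementarily equivalent to it, every subset definable with parameters is definable, with parameters, by a quantifier-free formula in the language $\{C\}$. A structure is called $\aleph_0$-categorical if its complete theory has at most one model of cardinality $\aleph_0$ up to isomorphism (finite structures are included), and indiscernible if all its elements have the same complete type over $\emptyset$. The canonical tree $T(M)$ is the partial order obtained from $M^2$ with the preorder $(\alpha,\beta)\preccurlyeq(\gamma,\delta)\iff\neg C(\gamma,\alpha,\beta)\wedge\neg C(\delta,\alpha,\beta)$ by identifying equivalent pairs. The class of $(\alpha,\beta)$ is written $\alpha\wedge\beta$, and $\alpha\in M$ is identified with the leaf $\alpha\wedge\alpha$. Let $T^*=T(M)$ if $T(M)$ has a least element, and $T^*=T(M)\cup\{-\infty\}$, with $-\infty$ below everything, otherwise. For $a\in T^*$ and $y\in T(M)$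 with $a<y$, the cone of $y$ at (the basis) $a$ is $\mathcal C(a,y)=\{\gamma\in M:\exists z\in T(M),\ a<z\le y,\ z\le\gamma\}$. For $a\in T(M)$, the thick cone at $a$ is $\mathcal C(a)=\{\gamma\in M: a\le\gamma\}$. For $a\in T^*$ and $b\in T(M)$ with $a<b$, the pruned cone with axis $]a,b[$ is $\mathcal C(]a,b[)=\mathcal C(a,b)\setminus\mathcal C(b)$. The canonical partition of an $\aleph_0$-categorical structure $M$ is its unique partition into finitely many $\emptyset$-definable maximal indiscernible subsets, where a subset is indiscernible if its elements all have the same complete type over $\emptyset$ in $M$. A subset of $M$ is $\mathrm{acl}(\emptyset)$-definable if it is definable over elements, possibly imaginary (such as elements of $T(M)$), that are algebraic over $\emptyset$. The orbit over $\emptyset$ of a set $X$ defined by $\varphi(x,c)$ is the union of its conjugates, which are the sets defined by $\varphi(x,c')$ with $c'$ in $M$ of the same type as $c$ over $\emptyset$. **Proposition.** Let $M$ be a $C$-minimal, $\aleph_0$-categorical $C$-structure. Then the canonical partition of $M$ exists and is unique, and each of its pieces $M_i$ has the following properties. (1) $M_i$ is the orbit over $\emptyset$ of an $\mathrm{acl}(\emptyset)$-definable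 nonempty set $X\subseteq M$ of one of the following forms: - a finite union of cones at a same basis $a\in T^*$; - an almost thick cone, i.e. $\mathcal C(a)\setminus\bigcup_{y\in Y}\mathcal C(a,y)$ with $a\in T(M)$ and $Y$ a finite set of elements $y>a$ of $T(M)$; - a pruned cone $\mathcal C(]a,b[)$ with $a\in T^*$, $b\in T(M)$, $a<b$, where $]a,b[$ is a nonempty dense interval without end points. If $M$ is countable, $M_i$ is also the union of the images of $X$ under the automorphisms of $M$. (2) Let $M_i$ be endowed with the structure induced by $M$, whose language consists of all subsets of the powers $M_i^n$ that are definable in $M$ without parameters. Then $M_i$ is $C$-minimal (for the restriction of $C$), $\aleph_0$-categorical and indiscernible. -/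

import Mathlib

open FirstOrder

universe u v w

namespace CMin

/-! ## C-relations and the canonical tree -/

/-- The axioms of a `C`-relation. -/
structure IsCRelation {M : Type w} (C : M → M → M → Prop) : Prop where
  symm : ∀ x y z, C x y z → C x z y
  asymm : ∀ x y z, C x y z → ¬ C y x z
  trans : ∀ x y z t, C x y z → C x y t ∨ C t y z
  ne : ∀ x y, x ≠ y → C x y y

/-- The type of pairs of elements of a `C`-set, carrying the preorder below. -/
def Pairs {M : Type w} {C : M → M → M → Prop} (_h : IsCRelation C) : Type w := M × M

/-- The preorder `(α, β) ≼ (γ, δ) ↔ ¬ C(γ, α, β) ∧ ¬ C(δ, α, β)` on pairs. -/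
instance {M : Type w} {C : M → M → M → Prop} (h : IsCRelation C) : Preorder (Pairs h) where
  le p q := ¬ C q.1 p.1 p.2 ∧ ¬ C q.2 p.1 p.2
  le_refl p := ⟨fun H => h.asymm _ _ _ H H, fun H =>
    h.asymm _ _ _ (h.symm _ _ _ H) (h.symm _ _ _ H)⟩
  le_trans p q r hpq hqr := by
    have key : ∀ e, ¬ C e q.1 q.2 → ¬ C e p.1 p.2 := by
      intro e he H
      have h1 : C e p.1 q.1 := (h.trans _ _ _ q.1 H).resolve_right hpq.1
      have h2 : C e p.1 q.2 := (h.trans _ _ _ q.2 H).resolve_right hpq.2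
      have h3 : C q.2 q.1 p.1 := (h.trans _ _ _ q.2 (h.symm _ _ _ h1)).resolve_left he
      have h4 : C q.1 q.2 p.1 := (h.trans _ _ _ q.1 (h.symm _ _ _ h2)).resolve_left
        (fun H' => he (h.symm _ _ _ H'))
      exact h.asymm _ _ _ h3 h4
    exact ⟨key _ hqr.1, key _ hqr.2⟩

/-- The canonical tree `T(M)` of a `C`-set `M`: the quotient of `M × M` by the equivalence
relation associated with the preorder, with the induced partial order. -/
abbrev Tree {M : Type w} {C : M → M → M → Prop} (h : IsCRelation C) : Type w :=
  Antisymmetrization (Pairs h) (· ≤ ·)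

/-- The element `α ∧ β` of the canonical tree. -/
def meet {M : Type w} {C : M → M → M → Prop} (h : IsCRelation C) (α β : M) : Tree h :=
  toAntisymmetrization (· ≤ ·) ((α, β) : Pairs h)

/-- The leaf of the canonical tree that represents `α`. -/
def leaf {M : Type w} {C : M → M → M → Prop} (h : IsCRelation C) (α : M) : Tree h :=
  meet h α α

/-- `a` belongs to `T(M)*`, which is `T(M)` if `T(M)` has a root, and `T(M) ∪ {-∞}` otherwise
(the element `-∞` is `⊥`). -/
def InTreeStar {M : Type w} {C : M → M → M → Prop} (h : IsCRelation C)
    (a : WithBot (Tree h)) : Prop :=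
  a = ⊥ → ¬ ∃ r : Tree h, ∀ t, r ≤ t

/-- The cone `𝒞(a, y)` of `y` at `a`, meant for `a < y`: the elements `γ` of `M` whose branch
meets the branch below `y` strictly above `a`. -/
def cone {M : Type w} {C : M → M → M → Prop} (h : IsCRelation C)
    (a : WithBot (Tree h)) (y : Tree h) : Set M :=
  {γ | ∃ z : Tree h, a < (z : WithBot (Tree h)) ∧ z ≤ y ∧ z ≤ leaf h γ}

/-- The thick cone `𝒞(x)` at `x`. -/
def thickCone {M : Type w} {C : M → M → M → Prop} (h : IsCRelation C)
    (x : Tree h) : Set M :=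
  {γ | x ≤ leaf h γ}

/-- The pruned cone `𝒞(]a, b[)`. -/
def prunedCone {M : Type w} {C : M → M → M → Prop} (h : IsCRelation C)
    (a : WithBot (Tree h)) (b : Tree h) : Set M :=
  cone h a b \ thickCone h b

/-- `X` is a (nonempty) finite union of cones at a same basis. -/
def IsFiniteUnionOfCones {M : Type w} {C : M → M → M → Prop} (h : IsCRelation C)
    (X : Set M) : Prop :=
  ∃ (a : WithBot (Tree h)) (Y : Set (Tree h)), InTreeStar h a ∧ Y.Finite ∧ Y.Nonempty ∧
    (∀ y ∈ Y, a < (y : WithBot (Tree h))) ∧ X = ⋃ y ∈ Y, cone h a y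

/-- `X` is a (nonempty) almost thick cone: a thick cone without finitely many of the cones at its
basis. -/
def IsAlmostThickCone {M : Type w} {C : M → M → M → Prop} (h : IsCRelation C)
    (X : Set M) : Prop :=
  ∃ (a : Tree h) (Y : Set (Tree h)), Y.Finite ∧ (∀ y ∈ Y, a < y) ∧ X.Nonempty ∧
    X = thickCone h a \ ⋃ y ∈ Y, cone h a y

/-- `X` is a pruned cone `𝒞(]a, b[)` with `a < b` whose axis `]a, b[` is a (nonempty) dense
interval without end points. -/
def IsDensePrunedCone {M : Type w} {C : M → M → M → Prop} (h : IsCRelation C)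
    (X : Set M) : Prop :=
  ∃ (a : WithBot (Tree h)) (b : Tree h), InTreeStar h a ∧ a < (b : WithBot (Tree h)) ∧
    (Set.Ioo a (b : WithBot (Tree h))).Nonempty ∧
    DenselyOrdered (Set.Ioo a (b : WithBot (Tree h))) ∧
    NoMinOrder (Set.Ioo a (b : WithBot (Tree h))) ∧
    NoMaxOrder (Set.Ioo a (b : WithBot (Tree h))) ∧
    X = prunedCone h a b

/-! ## C-minimality -/

/-- The symbols of the language `{C}`. -/
inductive PureSymbol : ℕ → Type
  | C : PureSymbol 3

/-- The pure language `{C}`, with one ternary relation symbol. -/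
def pureLanguage : FirstOrder.Language.{0, 0} := ⟨fun _ => Empty, PureSymbol⟩

/-- The `{C}`-structure given by a ternary relation. -/
@[reducible] def pureStructure {N : Type w} (C : N → N → N → Prop) : pureLanguage.Structure N where
  funMap f := Empty.elim f
  RelMap {_} r := match r with
    | PureSymbol.C => fun x => C (x 0) (x 1) (x 2)

/-- `S` is definable with parameters by a quantifier free formula of the pure language `{C}`.
Each element of `N` serves as a variable of the formula, assigned to itself, so that these
variables are the parameters; one more variable runs over the set. -/
def IsQFDefinable {N : Type w} (C : N → N → N → Prop) (S : Set N) : Prop :=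
  ∃ φ : pureLanguage.Formula (N ⊕ Unit), φ.IsQF ∧
    S = {x | letI := pureStructure C; φ.Realize (Sum.elim id (fun _ => x))}

/-- The ternary relation on `N` named by the symbol `c`. -/
def crel {L : FirstOrder.Language.{u, v}} (c : L.Relations 3) (N : Type w) [L.Structure N]
    (x y z : N) : Prop :=
  FirstOrder.Language.Structure.RelMap c ![x, y, z]

/-- `M` is a `C`-minimal `C`-structure, where `c` is the symbol of `L` for the `C`-relation. -/
def IsCMinimal {L : FirstOrder.Language.{u, v}} (c : L.Relations 3) (M : Type w) [L.Structure M] : Prop :=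
  IsCRelation (crel c M) ∧
    ∀ (N : Type w) [L.Structure N], M ≅[L] N →
      ∀ S : Set N, (Set.univ : Set N).Definable₁ L S → IsQFDefinable (crel c N) S

/-! ## Types, indiscernibility, categoricity -/

/-- The tuples `p` and `q` have the same complete type over `∅`. -/
def SameType (L : FirstOrder.Language.{u, v}) {M : Type w} [L.Structure M] {ι : Type} (p q : ι → M) : Prop :=
  ∀ φ : L.Formula ι, φ.Realize p ↔ φ.Realize q

/-- All elements of `A` have the same complete type over `∅` in `M`. -/
def IsIndiscernibleSet (L : FirstOrder.Language.{u, v}) {M : Type w} [L.Structure M] (A : Set M) : Prop :=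
  ∀ a ∈ A, ∀ b ∈ A, SameType L (fun _ : Unit => a) (fun _ : Unit => b)

/-- The structure `M` is indiscernible. -/
def IsIndiscernible (L : FirstOrder.Language.{u, v}) (M : Type w) [L.Structure M] : Prop :=
  IsIndiscernibleSet L (Set.univ : Set M)

/-- The complete theory of `M` has, up to isomorphism, at most one model of cardinality `ℵ₀`
(for a countable language: `M` is finite or its theory has exactly one such model). -/
def IsAlephZeroCategorical (L : FirstOrder.Language.{u, v}) (M : Type w) [L.Structure M] : Prop :=
  Cardinal.Categorical (Cardinal.aleph0 : Cardinal.{w}) (L.completeTheory M)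

/-- `P` is a canonical partition of `M`: a partition into finitely many `∅`-definable sets which
are maximal indiscernible. -/
def IsCanonicalPartition (L : FirstOrder.Language.{u, v}) {M : Type w} [L.Structure M]
    (P : Set (Set M)) : Prop :=
  Setoid.IsPartition P ∧ P.Finite ∧
    ∀ A ∈ P, (∅ : Set M).Definable₁ L A ∧ Maximal (IsIndiscernibleSet L) A

/-! ## Definability over `acl(∅)` and orbits -/

/-- The subset of `M` defined by the formula `φ` with parameters `p`. -/
def fiber {L : FirstOrder.Language.{u, v}} {M : Type w} [L.Structure M] {n : ℕ}
    (φ : L.Formula (Fin n ⊕ Unit)) (p : Fin n → M) : Set M :=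
  {x | φ.Realize (Sum.elim p (fun _ => x))}

/-- The imaginary element `p / E`, where `E` is an equivalence relation on `n`-tuples, is
algebraic over `∅`: it lies in a finite `∅`-definable set of classes. -/
def IsAlgebraicImaginary (L : FirstOrder.Language.{u, v}) {M : Type w} [L.Structure M] {n : ℕ}
    (E : Setoid (Fin n → M)) (p : Fin n → M) : Prop :=
  ∃ θ : L.Formula (Fin n), θ.Realize p ∧
    {e : Quotient E | ∃ q, θ.Realize q ∧ Quotient.mk E q = e}.Finite

/-- `X` is definable over `acl(∅)`, where `acl` includes imaginary elements, such as the nodes of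
the canonical tree: `X` is defined by a formula whose parameter is the class `p / E` of a tuple
for an `∅`-definable equivalence relation `E`, algebraic over `∅`. -/
def IsAclDefinable (L : FirstOrder.Language.{u, v}) {M : Type w} [L.Structure M] (X : Set M) : Prop :=
  ∃ (n : ℕ) (E : Setoid (Fin n → M)) (p : Fin n → M) (φ : L.Formula (Fin n ⊕ Unit)),
    (∃ ε : L.Formula (Fin n ⊕ Fin n), ∀ q r, E q r ↔ ε.Realize (Sum.elim q r)) ∧
    IsAlgebraicImaginary L E p ∧
    (∀ q r, E q r → fiber φ q = fiber φ r) ∧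
    X = fiber φ p

/-- `Y` is a conjugate of the definable set `X` over `∅`: they are defined by the same formula,
with parameters of the same type over `∅`. -/
def IsConjugate (L : FirstOrder.Language.{u, v}) {M : Type w} [L.Structure M] (X Y : Set M) : Prop :=
  ∃ (n : ℕ) (φ : L.Formula (Fin n ⊕ Unit)) (p q : Fin n → M),
    SameType L p q ∧ X = fiber φ p ∧ Y = fiber φ q

/-- The orbit over `∅` of the definable set `X`: the union of its conjugates over `∅`. -/
def orbit (L : FirstOrder.Language.{u, v}) {M : Type w} [L.Structure M] (X : Set M) : Set M :=
  ⋃₀ {Y | IsConjugate L X Y}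

/-! ## The induced structure -/

/-- The language of the structure induced by `M` on `A`: all subsets of the powers of `A` which are
definable in `M` without parameters. -/
def inducedLanguage (L : FirstOrder.Language.{u, v}) {M : Type w} [L.Structure M] (A : Set M) :
    FirstOrder.Language.{0, w} where
  Functions _ := Empty
  Relations n := {D : Set (Fin n → A) //
    (∅ : Set M).Definable L ((fun (x : Fin n → A) (i : Fin n) => (x i : M)) '' D)}

/-- The structure induced by `M` on `A`. -/
instance inducedStructure (L : FirstOrder.Language.{u, v}) {M : Type w} [L.Structure M] (A : Set M) :
    (inducedLanguage L A).Structure A where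
  funMap f := Empty.elim f
  RelMap D x := x ∈ D.1

theorem definable_induced_crel {L : FirstOrder.Language.{u, v}} (c : L.Relations 3) {M : Type w}
    [L.Structure M] {A : Set M} (hA : (∅ : Set M).Definable₁ L A) :
    (∅ : Set M).Definable L ((fun (x : Fin 3 → A) (i : Fin 3) => (x i : M)) ''
      {x : Fin 3 → A | crel c M (x 0) (x 1) (x 2)}) := by
  have hC : (∅ : Set M).Definable L {x : Fin 3 → M | crel c M (x 0) (x 1) (x 2)} := by
    refine Set.empty_definable_iff.2 ⟨c.formula ![FirstOrder.Language.Term.var 0, FirstOrder.Language.Term.var 1,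
      FirstOrder.Language.Term.var 2], ?_⟩
    ext x
    simp only [Set.mem_ofPred_eq, FirstOrder.Language.Formula.realize_rel, crel]
    apply iff_of_eq
    congr 1
    funext i
    fin_cases i <;> rfl
  have hi : ∀ i : Fin 3, (∅ : Set M).Definable L {x : Fin 3 → M | x i ∈ A} := fun i =>
    Set.Definable.preimage_comp (fun _ : Fin 1 => i) hA
  convert ((hC.inter (hi 0)).inter (hi 1)).inter (hi 2) using 1
  ext x
  constructor
  · rintro ⟨y, hy, rfl⟩
    exact ⟨⟨⟨hy, (y 0).2⟩, (y 1).2⟩, (y 2).2⟩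
  · rintro ⟨⟨⟨h, h0⟩, h1⟩, h2⟩
    refine ⟨![⟨x 0, h0⟩, ⟨x 1, h1⟩, ⟨x 2, h2⟩], h, ?_⟩
    funext i
    fin_cases i <;> rfl

/-- The symbol of the induced language for the restriction of the `C`-relation to `A`. -/
def inducedC {L : FirstOrder.Language.{u, v}} (c : L.Relations 3) {M : Type w} [L.Structure M] {A : Set M}
    (hA : (∅ : Set M).Definable₁ L A) : (inducedLanguage L A).Relations 3 :=
  ⟨{x : Fin 3 → A | crel c M (x 0) (x 1) (x 2)}, definable_induced_crel c hA⟩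

end CMin

/-! By Ryll-Nardzewski, categoricity means that for each n only finitely many types of n-tuples are
realized (`HasFiniteTypes`). Such types are isolated, so tuples of the same type can be extended in
parallel in any two elementarily equivalent structures, of any cardinality. The canonical partition
is then the partition into 1-types. If A is a piece, all its elements have the same type, so the
orbit of any nonempty `acl(∅)`-definable X ⊆ A is A. For (1) it remains to find one X ⊆ A of the
right form (`exists_form`).

C-minimality is used through finite sets F: membership in a definable set depends only on the
quantifier free type over F, which is governed by the nodes at which an element branches off from
those of F. Call a node mixed if its thick cone meets both A and its complement; every mixed node
lies below some f ∈ F. Above a maximal mixed node each cone is inside A or disjoint from A, and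
cones avoiding F all behave alike: this gives a finite union of cones or an almost thick cone. If A
has mixed nodes but no maximal one, some chain of mixed nodes converges to a node b that is not
mixed. The thick cone at b is then inside A, and serves as X, or disjoint from A, and then a pruned
cone with dense axis ending at b lies in A; density holds because an infinite discrete chain would
yield infinitely many types. There are finitely many maximal mixed nodes and finitely many limits b,
whence algebraicity over ∅.

For (2), formulas of the induced structure are formulas of M relativized to A, so only C-minimality
needs work: the parameters in F need not belong to A. A cone that meets A at α traces on A a set
determined by a cut in the chain of nodes where elements of A branch off from α. Finitely many
elements of A define this trace unless the cut is a gap, nonempty below and without end point on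
either side. An indiscernible definable set has no gaps (`not_isGap`): below the lowest gap of α one
finds γ ∈ A branching off from α beyond the influence of F; γ must also have a gap, which is forced
onto the part of the branch shared with α and so gives α a lower gap. Finally, finiteness of types
reduces C-minimality to a check in A itself (`isCMinimal_of_hasFiniteTypes`). -/

namespace CMin

/-! ## Types across structures -/

section Types

variable {L : FirstOrder.Language.{u, v}}

/-- The tuples `p` and `q`, possibly in different structures, have the same complete type. -/
def Same (L : FirstOrder.Language.{u, v}) {N₁ N₂ : Type*} [L.Structure N₁] [L.Structure N₂]
    {ι : Type*} (p : ι → N₁) (q : ι → N₂) : Prop :=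
  ∀ φ : L.Formula ι, φ.Realize p ↔ φ.Realize q

variable {N₁ N₂ N₃ : Type*} [L.Structure N₁] [L.Structure N₂] [L.Structure N₃] {ι κ : Type*}

theorem Same.refl (p : ι → N₁) : Same L p p := fun _ => Iff.rfl

theorem Same.symm {p : ι → N₁} {q : ι → N₂} (h : Same L p q) : Same L q p := fun φ => (h φ).symm

theorem Same.trans {p : ι → N₁} {q : ι → N₂} {r : ι → N₃} (h : Same L p q) (h' : Same L q r) :
    Same L p r := fun φ => (h φ).trans (h' φ)

theorem Same.comp {p : ι → N₁} {q : ι → N₂} (h : Same L p q) (f : κ → ι) :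
    Same L (p ∘ f) (q ∘ f) := fun φ => by
  simpa only [Language.Formula.realize_relabel] using h (φ.relabel f)

theorem Same.eq_iff {p : ι → N₁} {q : ι → N₂} (h : Same L p q) (i j : ι) :
    p i = p j ↔ q i = q j := by
  simpa [Language.Formula.realize_equal] using
    h ((Language.Term.var i).equal (Language.Term.var j))

theorem Same.elementarilyEquivalent {p : ι → N₁} {q : ι → N₂} (h : Same L p q) : N₁ ≅[L] N₂ := by
  rw [Language.elementarilyEquivalent_iff]
  intro φ
  have := h (Language.Formula.relabel (Empty.elim : Empty → ι) φ)
  rw [Language.Formula.realize_relabel, Language.Formula.realize_relabel] at this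
  rw [Language.Sentence.Realize, Language.Sentence.Realize]
  convert this

theorem same_of_isEmpty [IsEmpty ι] (h : N₁ ≅[L] N₂) (p : ι → N₁) (q : ι → N₂) : Same L p q := by
  intro φ
  have := (Language.elementarilyEquivalent_iff.1 h)
    (Language.Formula.relabel (isEmptyElim : ι → Empty) φ)
  rw [Language.Sentence.Realize, Language.Sentence.Realize, Language.Formula.realize_relabel,
    Language.Formula.realize_relabel] at this
  convert this

theorem forall_realize_iff [Finite ι] (h : N₁ ≅[L] N₂) (φ : L.Formula ι) :
    (∀ x : ι → N₁, φ.Realize x) ↔ ∀ x : ι → N₂, φ.Realize x := by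
  have := (Language.elementarilyEquivalent_iff.1 h)
    ((Language.Formula.relabel (Sum.inr : ι → Empty ⊕ ι) φ).iAlls ι)
  rw [Language.Sentence.Realize, Language.Sentence.Realize, Language.Formula.realize_iAlls,
    Language.Formula.realize_iAlls] at this
  simpa only [Language.Formula.realize_relabel, Function.comp_def, Sum.elim_inr] using this

/-- The relation of having the same type. -/
def typeSetoid (L : FirstOrder.Language.{u, v}) (N : Type*) [L.Structure N] (ι : Type*) :
    Setoid (ι → N) where
  r := Same L
  iseqv := ⟨Same.refl, Same.symm, Same.trans⟩

/-- For each `n`, finitely many types of `n`-tuples are realized in `N`. -/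
def HasFiniteTypes (L : FirstOrder.Language.{u, v}) (N : Type*) [L.Structure N] : Prop :=
  ∀ n : ℕ, Finite (Quotient (typeSetoid L N (Fin n)))

theorem HasFiniteTypes.finite (h : HasFiniteTypes L N₁) (ι : Type*) [Finite ι] :
    Finite (Quotient (typeSetoid L N₁ ι)) := by
  obtain ⟨n, ⟨e⟩⟩ := Finite.exists_equiv_fin ι
  have := h n
  refine Finite.of_injective (β := Quotient (typeSetoid L N₁ (Fin n)))
    (Quotient.map' (fun p => p ∘ e.symm) fun p q hpq => Same.comp hpq e.symm) ?_
  rintro ⟨p⟩ ⟨q⟩ hpq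
  have h1 : Same L (p ∘ e.symm) (q ∘ e.symm) := Quotient.exact hpq
  have h2 := h1.comp e
  refine Quotient.sound (s := typeSetoid L N₁ ι) (?_ : Same L p q)
  simpa [Function.comp_assoc] using h2

/-- If there are finitely many types, each is isolated by a formula. -/
theorem HasFiniteTypes.isolate (h : HasFiniteTypes L N₁) [Finite ι] (x : ι → N₁) :
    ∃ θ : L.Formula ι, θ.Realize x ∧ ∀ y : ι → N₁, θ.Realize y → Same L x y := by
  have := h.finite ι
  have key : ∀ c : Quotient (typeSetoid L N₁ ι), ∃ θ : L.Formula ι, θ.Realize x ∧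
      ∀ y, Quotient.mk _ y = c → θ.Realize y → Same L x y := by
    rintro ⟨z⟩
    by_cases hxz : Same L x z
    · exact ⟨⊤, by simp, fun y hy _ => hxz.trans (Quotient.exact hy : Same L y z).symm⟩
    · obtain ⟨θ, hθ⟩ := not_forall.1 hxz
      have aux : ∃ θ : L.Formula ι, θ.Realize x ∧ ¬ θ.Realize z := by
        by_cases h1 : θ.Realize x
        · exact ⟨θ, h1, fun h2 => hθ (iff_of_true h1 h2)⟩
        · refine ⟨θ.not, by simpa using h1, fun h2 => hθ (iff_of_false h1 (by simpa using h2))⟩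
      obtain ⟨θ, h1, h2⟩ := aux
      exact ⟨θ, h1, fun y hy h3 => absurd (((Quotient.exact hy : Same L y z) θ).1 h3) h2⟩
  choose θ h1 h2 using key
  refine ⟨Language.Formula.iInf θ, by simpa using h1, fun y hy => ?_⟩
  exact h2 _ y rfl (by simpa using (Language.Formula.realize_iInf.1 hy) _)

/-- That `θ` implies `χ` is a universal statement without parameters, so it passes from `N₁` to
`N₂`. -/
theorem same_of_isolates [Finite ι] (h : N₁ ≅[L] N₂) {x : ι → N₁} {θ : L.Formula ι}
    (hθ : ∀ y : ι → N₁, θ.Realize y → Same L x y) {z : ι → N₂} (hz : θ.Realize z) :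
    Same L x z := by
  have key : ∀ χ : L.Formula ι, χ.Realize x → χ.Realize z := by
    intro χ hχ
    have h1 := (forall_realize_iff h (θ.imp χ)).1
      (fun y => Language.Formula.realize_imp.2 fun hy => (hθ y hy χ).1 hχ)
    exact Language.Formula.realize_imp.1 (h1 z) hz
  refine fun χ => ⟨key χ, fun hχ => ?_⟩
  by_contra hc
  exact Language.Formula.realize_not.1 (key χ.not (Language.Formula.realize_not.2 hc)) hχ

/-- The finite disjunction of the isolating formulas is valid in `N₁`, hence in `N₂`: no new type
appears there. -/
theorem HasFiniteTypes.exists_same (h : HasFiniteTypes L N₁) (e : N₁ ≅[L] N₂) [Finite ι]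
    (z : ι → N₂) : ∃ x : ι → N₁, Same L x z := by
  have := h.finite ι
  choose θ h1 h2 using fun x : ι → N₁ => h.isolate x
  have key := (forall_realize_iff e (Language.Formula.iSup
    fun c : Quotient (typeSetoid L N₁ ι) => θ c.out)).1 (fun x => by
      refine Language.Formula.realize_iSup.2 ⟨Quotient.mk _ x, ?_⟩
      have : Same L (Quotient.mk (typeSetoid L N₁ ι) x).out x := Quotient.mk_out (s := typeSetoid L N₁ ι) x
      exact (this _).1 (h1 _)) z
  obtain ⟨c, hc⟩ := Language.Formula.realize_iSup.1 key
  exact ⟨_, same_of_isolates e (h2 _) hc⟩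

theorem HasFiniteTypes.congr (h : HasFiniteTypes L N₁) (e : N₁ ≅[L] N₂) : HasFiniteTypes L N₂ := by
  intro n
  have := h n
  choose f hf using fun z : Fin n → N₂ => h.exists_same e z
  refine Finite.of_injective (β := Quotient (typeSetoid L N₁ (Fin n)))
    (fun c => Quotient.mk _ (f c.out)) ?_
  intro c d hcd
  have h1 : Same L (f c.out) (f d.out) := Quotient.exact hcd
  have h2 : Same L c.out d.out := ((hf _).symm.trans h1).trans (hf _)
  rw [← Quotient.out_eq c, ← Quotient.out_eq d]
  exact Quotient.sound (s := typeSetoid L N₂ (Fin n)) h2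

/-- The formula isolating the type of `(p, a)`, with the variables of `a` quantified existentially,
is in the type of `p`, hence in that of `q`. Isolation thus replaces saturation. -/
theorem HasFiniteTypes.extend (h : HasFiniteTypes L N₁) [Finite ι] [Finite κ] {p : ι → N₁}
    {q : ι → N₂} (hpq : Same L p q) (a : κ → N₁) :
    ∃ b : κ → N₂, Same L (Sum.elim p a) (Sum.elim q b) := by
  obtain ⟨θ, h1, h2⟩ := h.isolate (Sum.elim p a)
  obtain ⟨b, hb⟩ := Language.Formula.realize_iExs.1
    ((hpq (θ.iExs κ)).1 (Language.Formula.realize_iExs.2 ⟨a, h1⟩))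
  exact ⟨b, same_of_isolates hpq.elementarilyEquivalent h2 hb⟩

theorem HasFiniteTypes.extend' (h : HasFiniteTypes L N₁) [Finite ι] [Finite κ] {p : ι → N₁}
    {q : ι → N₂} (hpq : Same L p q) (b : κ → N₂) :
    ∃ a : κ → N₁, Same L (Sum.elim p a) (Sum.elim q b) := by
  obtain ⟨a, ha⟩ := (h.congr hpq.elementarilyEquivalent).extend hpq.symm b
  exact ⟨a, ha.symm⟩

end Types

/-! ## Back and forth -/

section BackAndForth

variable {L : FirstOrder.Language.{u, v}} {N₁ N₂ : Type*} [L.Structure N₁] [L.Structure N₂]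

/-- Finite partial elementary maps, given by two tuples of the same type. -/
structure PartialElem (L : FirstOrder.Language.{u, v}) (N₁ N₂ : Type*) [L.Structure N₁]
    [L.Structure N₂] where
  /-- the length of the tuples -/
  n : ℕ
  /-- the tuple in the first structure -/
  p : Fin n → N₁
  /-- the tuple in the second structure -/
  q : Fin n → N₂
  same : Same L p q

instance : Preorder (PartialElem L N₁ N₂) where
  le s t := ∃ g : Fin s.n → Fin t.n, s.p = t.p ∘ g ∧ s.q = t.q ∘ g
  le_refl s := ⟨id, rfl, rfl⟩
  le_trans := by
    rintro s t r ⟨g, h1, h2⟩ ⟨g', h1', h2'⟩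
    exact ⟨g' ∘ g, by rw [h1, h1']; rfl, by rw [h2, h2']; rfl⟩

theorem PartialElem.extend (h : HasFiniteTypes L N₁) (s : PartialElem L N₁ N₂) :
    (∀ a, ∃ t, s ≤ t ∧ ∃ i, t.p i = a) ∧ ∀ b, ∃ t, s ≤ t ∧ ∃ i, t.q i = b := by
  have key : ∀ (a : Unit → N₁) (b : Unit → N₂), Same L (Sum.elim s.p a) (Sum.elim s.q b) →
      ∃ t, s ≤ t ∧ ∃ i, t.p i = a () ∧ t.q i = b () := by
    intro a b hab
    obtain ⟨e⟩ : Nonempty (Fin (s.n + 1) ≃ Fin s.n ⊕ Unit) :=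
      ⟨finSumFinEquiv.symm.trans (Equiv.sumCongr (Equiv.refl _) finOneEquiv)⟩
    refine ⟨⟨s.n + 1, _, _, hab.comp e⟩, ⟨e.symm ∘ Sum.inl, ?_, ?_⟩, e.symm (Sum.inr ()), ?_, ?_⟩
    · funext i; simp
    · funext i; simp
    · simp
    · simp
  constructor
  · intro a
    obtain ⟨b, hb⟩ := h.extend s.same (fun _ : Unit => a)
    obtain ⟨t, h1, i, h2, -⟩ := key _ b hb
    exact ⟨t, h1, i, h2⟩
  · intro b
    obtain ⟨a, ha⟩ := h.extend' s.same (fun _ : Unit => b)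
    obtain ⟨t, h1, i, -, h2⟩ := key a _ ha
    exact ⟨t, h1, i, h2⟩

/-- Tuples of the same type in countable structures with finitely many types are related by an
isomorphism. -/
theorem HasFiniteTypes.exists_equiv [Countable N₁] [Countable N₂] (h : HasFiniteTypes L N₁) {n : ℕ}
    {p : Fin n → N₁} {q : Fin n → N₂} (hpq : Same L p q) :
    ∃ e : N₁ ≃[L] N₂, ∀ i, e (p i) = q i := by
  have := Encodable.ofCountable N₁
  have := Encodable.ofCountable N₂
  let D : N₁ ⊕ N₂ → Order.Cofinal (PartialElem L N₁ N₂) := Sum.elim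
    (fun a => ⟨{t | ∃ i, t.p i = a}, fun s => by
      obtain ⟨t, h1, h2⟩ := (s.extend h).1 a; exact ⟨t, h2, h1⟩⟩)
    (fun b => ⟨{t | ∃ i, t.q i = b}, fun s => by
      obtain ⟨t, h1, h2⟩ := (s.extend h).2 b; exact ⟨t, h2, h1⟩⟩)
  -- A generic ideal of finite partial elementary maps: it meets the countably many cofinal sets
  -- which put a given element into the domain or the range.
  let I := Order.idealOfCofinals ⟨n, p, q, hpq⟩ D
  have dir : ∀ s ∈ I, ∀ t ∈ I, ∃ r ∈ I, s ≤ r ∧ t ≤ r := fun s hs t ht => I.directed s hs t ht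
  have left : ∀ a, ∃ t ∈ I, ∃ i, t.p i = a := fun a => by
    obtain ⟨t, h1, h2⟩ := Order.cofinal_meets_idealOfCofinals ⟨n, p, q, hpq⟩ D (Sum.inl a)
    exact ⟨t, h2, h1⟩
  have right : ∀ b, ∃ t ∈ I, ∃ i, t.q i = b := fun b => by
    obtain ⟨t, h1, h2⟩ := Order.cofinal_meets_idealOfCofinals ⟨n, p, q, hpq⟩ D (Sum.inr b)
    exact ⟨t, h2, h1⟩
  choose t ht i hi using left
  let f : N₁ → N₂ := fun a => (t a).q (i a)
  -- The value of `f` does not depend on the chosen map: two members of `I` have a common extension,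
  -- and elementary maps respect equality.
  have hf : ∀ s ∈ I, ∀ j, f (s.p j) = s.q j := by
    intro s hs j
    obtain ⟨r, -, ⟨g, h1, h2⟩, ⟨g', h1', h2'⟩⟩ := dir s hs _ (ht (s.p j))
    have : r.p (g' (i (s.p j))) = r.p (g j) := by
      have e1 := congrFun h1' (i (s.p j))
      have e2 := congrFun h1 j
      rw [hi] at e1
      exact e1.symm.trans e2
    have e3 := (r.same.eq_iff _ _).1 this
    have e4 := congrFun h2' (i (s.p j))
    have e5 := congrFun h2 j
    exact e4.trans (e3.trans e5.symm)
  -- Elementarity concerns finite tuples, and each of them is covered by a single member of `I`.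
  have common : ∀ (k : ℕ) (x : Fin k → N₁), ∃ s ∈ I, ∃ g : Fin k → Fin s.n, ∀ j, s.p (g j) = x j := by
    intro k
    induction k with
    | zero => exact fun x => ⟨_, Order.mem_idealOfCofinals _ D, Fin.elim0, fun j => j.elim0⟩
    | succ k ih =>
      intro x
      obtain ⟨s, hs, g, hg⟩ := ih (fun j => x j.succ)
      obtain ⟨r, hr, ⟨g1, h1, -⟩, ⟨g2, h2, -⟩⟩ := dir s hs _ (ht (x 0))
      refine ⟨r, hr, Fin.cons (g2 (i (x 0))) (g1 ∘ g), Fin.cases ?_ fun j => ?_⟩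
      · simpa [hi] using (congrFun h2 (i (x 0))).symm
      · simpa [hg] using (congrFun h1 (g j)).symm
  let F : N₁ ↪ₑ[L] N₂ := ⟨f, fun k φ x => by
    obtain ⟨s, hs, g, hg⟩ := common k x
    have h1 : x = s.p ∘ g := funext fun j => (hg j).symm
    have h2 : f ∘ x = s.q ∘ g := by rw [h1]; exact funext fun j => hf s hs _
    rw [h2, h1]
    exact (s.same.comp g φ).symm⟩
  have hbij : Function.Bijective F := by
    refine ⟨F.injective, fun b => ?_⟩
    obtain ⟨s, hs, j, hj⟩ := right b
    exact ⟨s.p j, (hf s hs j).trans hj⟩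
  exact ⟨⟨Equiv.ofBijective F hbij, fun φ x => F.map_fun φ x, fun r x => F.map_rel r x⟩,
    fun j => hf ⟨n, p, q, hpq⟩ (Order.mem_idealOfCofinals _ D) j⟩

theorem HasFiniteTypes.isAlephZeroCategorical {M : Type w} [L.Structure M]
    (h : HasFiniteTypes L M) : IsAlephZeroCategorical L M := by
  intro A B hA hB
  have : Countable A := Cardinal.mk_le_aleph0_iff.1 hA.le
  have : Countable B := Cardinal.mk_le_aleph0_iff.1 hB.le
  have e : ∀ X : (L.completeTheory M).ModelType, M ≅[L] X := fun X => by
    rw [Language.elementarilyEquivalent_iff]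
    intro φ
    exact (Language.realize_iff_of_model_completeTheory M X φ).symm
  obtain ⟨f, -⟩ := (h.congr (e A)).exists_equiv
    (same_of_isEmpty ((e A).symm.trans (e B)) (Fin.elim0 : Fin 0 → A) (Fin.elim0 : Fin 0 → B))
  exact ⟨f⟩

end BackAndForth

/-! ## The Ryll-Nardzewski theorem -/

section RyllNardzewski

open Filter

variable {L : FirstOrder.Language.{u, v}} {M : Type w} [L.Structure M]

theorem realize_congr_of_freeVar {α : Type*} [DecidableEq α] (ψ : L.Formula α) {v v' : α → M}
    (h : ∀ a ∈ Language.BoundedFormula.freeVarFinset ψ, v a = v' a) :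
    ψ.Realize v ↔ ψ.Realize v' := by
  rw [Language.Formula.Realize, Language.Formula.Realize,
    ← Language.BoundedFormula.realize_restrictFreeVar (φ := ψ) (f := id) (v := fun a => v a) v
      (fun _ => rfl),
    ← Language.BoundedFormula.realize_restrictFreeVar (φ := ψ) (f := id) (v := fun a => v a) v'
      (fun a => h a a.2)]

/-- The projection to finitely many variables of the set defined by a formula is definable. -/
theorem exists_formula_projection [Nonempty M] {n : ℕ} (ψ : L.Formula ℕ) (i : Fin n → ℕ) :
    ∃ χ : L.Formula (Fin n), ∀ z : Fin n → M, χ.Realize z ↔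
      ∃ v : ℕ → M, ψ.Realize v ∧ v ∘ i = z := by
  classical
  let s : Finset ℕ := Language.BoundedFormula.freeVarFinset ψ ∪ Finset.univ.image i
  let ψ₀ : L.Formula s := Language.BoundedFormula.restrictFreeVar ψ
    (fun a => ⟨a, Finset.mem_union_left _ a.2⟩)
  have hψ₀ : ∀ v : ℕ → M, ψ₀.Realize (fun a : s => v a) ↔ ψ.Realize v := fun v =>
    Language.BoundedFormula.realize_restrictFreeVar v (fun _ => rfl)
  have hi : ∀ k, i k ∈ s := fun k =>
    Finset.mem_union_right _ (Finset.mem_image_of_mem i (Finset.mem_univ k))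
  have h0 : (∅ : Set M).Definable L {g : s → M | ψ₀.Realize g} :=
    Set.empty_definable_iff.2 ⟨ψ₀, rfl⟩
  obtain ⟨χ, hχ⟩ := Set.empty_definable_iff.1 (h0.image_comp (fun k : Fin n => (⟨i k, hi k⟩ : s)))
  refine ⟨χ, fun z => ?_⟩
  have h1 : χ.Realize z ↔ z ∈ Set.ofPred χ.Realize := Iff.rfl
  rw [h1, ← hχ]
  constructor
  · rintro ⟨g, hg, rfl⟩
    obtain ⟨m⟩ := ‹Nonempty M›
    let v : ℕ → M := fun a => if h : a ∈ s then g ⟨a, h⟩ else m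
    have hv : (fun a : s => v a) = g := funext fun a => by simp [v]
    refine ⟨v, (hψ₀ v).1 (by rw [hv]; exact hg), funext fun k => ?_⟩
    simp [v, hi]
  · rintro ⟨v, hv, rfl⟩
    exact ⟨fun a => v a, (hψ₀ v).2 hv, rfl⟩

/-- The ultrapower of `M` over the natural numbers. -/
abbrev Ultrapower (M : Type w) : Type w := ((hyperfilter ℕ : Ultrafilter ℕ) : Filter ℕ).Product
  (fun _ => M)

theorem elementarilyEquivalent_ultrapower [Nonempty M] : M ≅[L] Ultrapower M := by
  rw [Language.elementarilyEquivalent_iff]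
  intro φ
  rw [Language.Ultraproduct.sentence_realize]
  simp

/-- A finitely satisfiable type is realized in a countable elementarily equivalent structure. -/
theorem exists_countable_realizing [Countable L.Symbols] [Infinite M] {n : ℕ}
    (p : Set (L.Formula (Fin n)))
    (hp : ∀ s ⊆ p, s.Finite → ∃ x : Fin n → M, ∀ φ ∈ s, φ.Realize x) :
    ∃ S : L.ElementarySubstructure (Ultrapower M), Cardinal.mk S = Cardinal.aleph0 ∧
      ∃ x : Fin n → S, ∀ φ ∈ p, φ.Realize x := by
  have := Encodable.ofCountable (L.Formula (Fin n))
  have hfin : ∀ k, {φ : L.Formula (Fin n) | Encodable.encode φ ≤ k}.Finite := fun k =>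
    (Set.finite_Iic k).preimage (Encodable.encode_injective.injOn)
  choose y hy using fun k => hp (p ∩ {φ | Encodable.encode φ ≤ k}) Set.inter_subset_left
    ((hfin k).subset Set.inter_subset_right)
  -- The tuple `y k` satisfies the formulas of `p` with code at most `k`, so each formula of `p`
  -- holds at all but finitely many `k`, and Łoś's theorem applies.
  let x : Fin n → Ultrapower M := fun i => ((fun k => y k i : ℕ → M) : Ultrapower M)
  have hx : ∀ φ ∈ p, φ.Realize x := by
    intro φ hφ
    refine (Language.Ultraproduct.realize_formula_cast (u := hyperfilter ℕ) φ
      (fun i k => y k i)).2 ?_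
    refine Nat.hyperfilter_le_atTop ((eventually_ge_atTop (Encodable.encode φ)).mono ?_)
    exact fun k hk => hy k φ ⟨hφ, hk⟩
  have hinf : Infinite (Ultrapower M) := by
    exact (elementarilyEquivalent_ultrapower (L := L) (M := M)).infinite
  obtain ⟨S, hS, hS'⟩ := Language.exists_elementarySubstructure_card_eq L (Set.range x)
    Cardinal.aleph0.{w} le_rfl (by simp [(Set.countable_range x).le_aleph0])
    (by
      rw [Cardinal.lift_aleph0]
      exact Cardinal.lift_le_aleph0.2 Cardinal.mk_le_aleph0) (by simp)
  refine ⟨S, by simpa using hS', fun i => ⟨x i, hS ⟨i, rfl⟩⟩, fun φ hφ => ?_⟩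
  have := hx φ hφ
  exact (S.subtype.map_formula φ _).1 this

/-- The formulas in variables indexed by `ℕ` that are satisfiable in `M`, ordered by implication
in `M`, the stronger formulas being the larger ones. -/
def Conditions (L : FirstOrder.Language.{u, v}) (M : Type w) [L.Structure M] : Type (max u v) :=
  {ψ : L.Formula ℕ // ∃ v : ℕ → M, ψ.Realize v}

instance : Preorder (Conditions L M) where
  le ψ χ := ∀ v : ℕ → M, χ.1.Realize v → ψ.1.Realize v
  le_refl _ _ h := h
  le_trans _ _ _ h h' v hv := h v (h' v hv)

/-- The omitting types theorem, for a family of formulas that is not isolated in `M`. -/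
theorem exists_countable_omitting [Countable L.Symbols] [Infinite M] {n : ℕ}
    (p : Set (L.Formula (Fin n)))
    (hp : ∀ χ : L.Formula (Fin n), (∃ x : Fin n → M, χ.Realize x) →
      ∃ x : Fin n → M, χ.Realize x ∧ ∃ φ ∈ p, ¬ φ.Realize x) :
    ∃ S : L.ElementarySubstructure (Ultrapower M), Countable S ∧
      ∀ x : Fin n → S, ∃ φ ∈ p, ¬ φ.Realize x := by
  classical
  have := Encodable.ofCountable (L.Formula (ℕ ⊕ Fin 1))
  have := Encodable.ofCountable (Fin n → ℕ)
  -- Two countable families of cofinal sets. The first consists of Henkin conditions: some variable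
  -- is a witness for `φ` whenever there is one. The second makes a formula of `p` fail at a given
  -- tuple of variables.
  let D : L.Formula (ℕ ⊕ Fin 1) ⊕ (Fin n → ℕ) → Order.Cofinal (Conditions L M) := Sum.elim
    (fun φ => ⟨{ψ | ∃ j, ∀ v : ℕ → M, ψ.1.Realize v →
        ∀ y : Fin 1 → M, φ.Realize (Sum.elim v y) → φ.Realize (Sum.elim v (fun _ => v j))}, by
      rintro ⟨ψ, v, hv⟩
      -- A fresh variable, whose value can be changed without affecting `ψ` or the parameters of
      -- `φ`.
      obtain ⟨j, hj⟩ := Infinite.exists_notMem_finset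
        (Language.BoundedFormula.freeVarFinset ψ ∪
          (Language.BoundedFormula.freeVarFinset φ).preimage Sum.inl Sum.inl_injective.injOn)
      rw [Finset.mem_union, not_or, Finset.mem_preimage] at hj
      by_cases hy : ∃ y : Fin 1 → M, φ.Realize (Sum.elim v y)
      · obtain ⟨y, hy⟩ := hy
        let φ' : L.Formula ℕ := φ.relabel (Sum.elim id (fun _ => j))
        have hφ' : ∀ v' : ℕ → M, φ'.Realize v' ↔ φ.Realize (Sum.elim v' (fun _ => v' j)) := by
          intro v'
          rw [Language.Formula.realize_relabel]
          refine iff_of_eq (congrArg _ (funext ?_))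
          rintro (a | a) <;> rfl
        refine ⟨⟨ψ ⊓ φ', Function.update v j (y 0), ?_⟩, ⟨j, fun v' hv' _ _ => ?_⟩,
          fun v' hv' => (Language.Formula.realize_inf.1 hv').1⟩
        · refine Language.Formula.realize_inf.2 ⟨(realize_congr_of_freeVar ψ ?_).1 hv,
            (hφ' _).2 ((realize_congr_of_freeVar φ ?_).1 hy)⟩
          · intro a ha
            rw [Function.update_of_ne]
            rintro rfl
            exact hj.1 ha
          · rintro (a | a) ha
            · simp only [Sum.elim_inl]
              rw [Function.update_of_ne]
              rintro rfl
              exact hj.2 ha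
            · simp [Subsingleton.elim a 0]
        · exact (hφ' v').1 (Language.Formula.realize_inf.1 hv').2
      · let φ' : L.Formula ℕ := (φ.iExs (Fin 1)).not
        have hφ' : ∀ v' : ℕ → M, φ'.Realize v' ↔ ¬ ∃ y : Fin 1 → M, φ.Realize (Sum.elim v' y) := by
          intro v'
          rw [Language.Formula.realize_not, Language.Formula.realize_iExs]
        refine ⟨⟨ψ ⊓ φ', v, Language.Formula.realize_inf.2 ⟨hv, (hφ' v).2 hy⟩⟩,
          ⟨0, fun v' hv' y hy' => ?_⟩, fun v' hv' => (Language.Formula.realize_inf.1 hv').1⟩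
        exact absurd ⟨y, hy'⟩ ((hφ' v').1 (Language.Formula.realize_inf.1 hv').2)⟩)
    (fun i => ⟨{ψ | ∃ φ ∈ p, ∀ v : ℕ → M, ψ.1.Realize v → ¬ φ.Realize (v ∘ i)}, by
      rintro ⟨ψ, v, hv⟩
      -- All that `ψ` says of the variables `i` is `χ`; by `hp` it leaves room for a tuple at which
      -- some formula of `p` fails.
      obtain ⟨χ, hχ⟩ := exists_formula_projection (M := M) ψ i
      obtain ⟨x, hx, φ, hφ, hφx⟩ := hp χ ⟨v ∘ i, (hχ _).2 ⟨v, hv, rfl⟩⟩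
      obtain ⟨v', hv', rfl⟩ := (hχ x).1 hx
      refine ⟨⟨ψ ⊓ (φ.relabel i).not, v', ?_⟩, ⟨φ, hφ, fun v'' hv'' => ?_⟩,
        fun v'' hv'' => (Language.Formula.realize_inf.1 hv'').1⟩
      · refine Language.Formula.realize_inf.2 ⟨hv', Language.Formula.realize_not.2 ?_⟩
        rwa [Language.Formula.realize_relabel]
      · have := Language.Formula.realize_not.1 (Language.Formula.realize_inf.1 hv'').2
        rwa [Language.Formula.realize_relabel] at this⟩)
  obtain ⟨m⟩ : Nonempty M := inferInstance
  let c₀ : Conditions L M := ⟨⊤, fun _ => m, by simp⟩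
  let s : ℕ → Conditions L M := Order.sequenceOfCofinals c₀ D
  have hmono : Monotone s := Order.sequenceOfCofinals.monotone c₀ D
  have hmem : ∀ d, s (Encodable.encode d + 1) ∈ D d := Order.sequenceOfCofinals.encode_mem c₀ D
  choose V hV using fun k => (s k).2
  have hVs : ∀ d : L.Formula (ℕ ⊕ Fin 1) ⊕ (Fin n → ℕ), ∀ᶠ k in (hyperfilter ℕ : Filter ℕ),
      (s (Encodable.encode d + 1)).1.Realize (V k) := fun d =>
    Nat.hyperfilter_le_atTop ((eventually_ge_atTop (Encodable.encode d + 1)).mono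
      fun k hk => hmono hk _ (hV k))
  let a : ℕ → Ultrapower M := fun j => ((fun k => V k j : ℕ → M) : Ultrapower M)
  -- Tarski–Vaught test: by Łoś's theorem the sequence `a` satisfies the generic conditions, and the
  -- Henkin ones provide a witness `a j` in each nonempty set definable over the range of `a`.
  have hmeets : L.MeetsDefinable (Set.range a) := by
    rintro E ⟨e, he⟩ hE
    obtain ⟨φ, hφ⟩ := Set.definable_iff_exists_formula_sum.1 hE
    have hE' : ∀ y : Fin 1 → Ultrapower M, y 0 ∈ E ↔ φ.Realize (Sum.elim (↑) y) := fun y => by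
      have : y 0 ∈ E ↔ y ∈ {x : Fin 1 → Ultrapower M | x 0 ∈ E} := Iff.rfl
      rw [this, hφ]; rfl
    choose g hg using fun b : Set.range a => b.2
    let φ' : L.Formula (ℕ ⊕ Fin 1) := φ.relabel (Sum.map g id)
    have hφ' : ∀ y : Fin 1 → Ultrapower M, φ'.Realize (Sum.elim a y) ↔ y 0 ∈ E := by
      intro y
      rw [hE', Language.Formula.realize_relabel]
      refine iff_of_eq (congrArg _ (funext ?_))
      rintro (b | b)
      · exact hg b
      · rfl
    obtain ⟨j, hj⟩ := hmem (Sum.inl φ')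
    obtain ⟨e', rfl⟩ : ∃ e' : ℕ → M, (e' : Ultrapower M) = e := Quotient.exists_rep e
    have cast : ∀ y : ℕ → M, φ'.Realize (Sum.elim a (fun _ => (y : Ultrapower M))) ↔
        ∀ᶠ k in (hyperfilter ℕ : Filter ℕ), φ'.Realize (Sum.elim (V k) (fun _ => y k)) := by
      intro y
      have := Language.Ultraproduct.realize_formula_cast (u := hyperfilter ℕ) φ'
        (Sum.elim (fun j k => V k j) (fun _ => y))
      have e1 : Sum.elim a (fun _ : Fin 1 => (y : Ultrapower M)) = fun i =>
          ((Sum.elim (fun j k => V k j) (fun _ => y) i : ℕ → M) : Ultrapower M) := by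
        funext b
        rcases b with b | b <;> rfl
      rw [e1]
      refine this.trans (eventually_congr (.of_forall fun k =>
        iff_of_eq (congrArg _ (funext ?_))))
      rintro (b | b) <;> rfl
    have h1 := (cast e').1 ((hφ' _).2 he)
    refine ⟨a j, (hφ' (fun _ => a j)).1 ((cast (fun k => V k j)).2 ?_), j, rfl⟩
    filter_upwards [h1, hVs (Sum.inl φ')] with k hk hk'
    exact hj (V k) hk' _ hk
  let S := hmeets.toElementarySubstructure
  have hS : ∀ b : S, ∃ j, a j = b := fun b => by
    have : (b : Ultrapower M) ∈ (Language.Substructure.closure L (Set.range a) : Set _) := b.2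
    rw [hmeets.closure_eq_self] at this
    exact this
  refine ⟨S, ?_, fun x => ?_⟩
  · choose f hf using hS
    exact Function.Injective.countable (f := f)
      fun b c hbc => Subtype.ext (by rw [← hf b, ← hf c, hbc])
  · choose i hi using fun k => hS (x k)
    obtain ⟨φ, hφ, hφ'⟩ := hmem (Sum.inr i)
    refine ⟨φ, hφ, fun hx => ?_⟩
    have h1 : φ.Realize (fun k => a (i k)) := by
      simp only [hi]
      exact (S.subtype.map_formula φ _).2 hx
    have h2 := (Language.Ultraproduct.realize_formula_cast (u := hyperfilter ℕ) φ
      (fun k l => V l (i k))).1 h1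
    obtain ⟨k, hk, hk'⟩ := (h2.and (hVs (Sum.inr i))).exists
    exact hφ' (V k) hk' hk

/-- The Ryll-Nardzewski theorem. -/
theorem IsAlephZeroCategorical.hasFiniteTypes [Countable L.Symbols]
    (hcat : IsAlephZeroCategorical L M) : HasFiniteTypes L M := by
  intro n
  rcases finite_or_infinite M with hM | hM
  · exact Quotient.finite _
  by_contra hinf
  rw [not_finite_iff_infinite] at hinf
  let Q := Quotient (typeSetoid L M (Fin n))
  -- The limit of the infinitely many types along a nonprincipal ultrafilter on the set of types.
  -- One countable model realizes it and another omits it, so they are not isomorphic.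
  let p : Set (L.Formula (Fin n)) := {φ | ∀ᶠ c : Q in (hyperfilter Q : Filter Q), φ.Realize c.out}
  have out_mk : ∀ x : Fin n → M, Same L (Quotient.mk _ x : Q).out x := fun x =>
    Quotient.mk_out (s := typeSetoid L M (Fin n)) x
  obtain ⟨S₁, hS₁, x, hx⟩ := exists_countable_realizing (M := M) p (fun s hs hfin => by
    have : ∀ᶠ c : Q in (hyperfilter Q : Filter Q), ∀ φ ∈ s, φ.Realize c.out :=
      (eventually_all_finite hfin).2 hs
    obtain ⟨c, hc⟩ := this.exists
    exact ⟨c.out, hc⟩)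
  -- If `χ` isolated `p`, only the type of `y` would contain `χ`; but `χ ∈ p` means that `χ` belongs
  -- to a set of types in the ultrafilter, which cannot be finite.
  obtain ⟨S₂, hS₂, hS₂'⟩ := exists_countable_omitting (M := M) p (fun χ hχ => by
    by_contra! hcon
    obtain ⟨y, hy⟩ := hχ
    have hyp : ∀ φ, φ ∈ p ↔ φ.Realize y := by
      refine fun φ => ⟨hcon y hy φ, fun h => ?_⟩
      by_contra hc
      have : φ.not ∈ p := (Ultrafilter.eventually_not.2 hc).mono
        fun c h => Language.Formula.realize_not.2 h
      exact Language.Formula.realize_not.1 (hcon y hy _ this) h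
    have hχp : ∀ᶠ c : Q in (hyperfilter Q : Filter Q), χ.Realize c.out := (hyp χ).2 hy
    refine Set.Finite.notMem_hyperfilter (Set.finite_singleton (Quotient.mk _ y : Q)) ?_
    refine mem_of_superset hχp fun c hc => ?_
    have : Same L c.out y := by
      refine fun φ => ⟨fun h => ?_, fun h => hcon _ hc φ ((hyp φ).2 h)⟩
      by_contra hc'
      exact Language.Formula.realize_not.1
        (hcon _ hc φ.not ((hyp _).2 (Language.Formula.realize_not.2 hc'))) h
    rw [Set.mem_singleton_iff, ← Quotient.out_eq c]
    exact Quotient.sound (s := typeSetoid L M (Fin n)) this)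
  have ee : ∀ S : L.ElementarySubstructure (Ultrapower M), M ≅[L] S := fun S =>
    elementarilyEquivalent_ultrapower.trans S.elementarilyEquivalent.symm
  have hinf₂ : Infinite S₂ := (ee S₂).infinite
  have model : ∀ S : L.ElementarySubstructure (Ultrapower M), S ⊨ L.completeTheory M := fun S =>
    ((ee S).theory_model_iff).1 inferInstance
  have := model S₁
  have := model S₂
  have : Nonempty S₁ := (ee S₁).nonempty
  obtain ⟨f⟩ := hcat (Language.Theory.ModelType.of _ S₁) (Language.Theory.ModelType.of _ S₂) hS₁
    (Cardinal.mk_eq_aleph0 S₂)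
  obtain ⟨φ, hφ, h⟩ := hS₂' (f ∘ x)
  exact h ((Language.StrongHomClass.realize_formula (f : S₁ ≃[L] S₂) φ).2 (hx φ hφ))

end RyllNardzewski

/-! ## The canonical tree -/

section Tree

variable {M : Type w} {C : M → M → M → Prop} (h : IsCRelation C)

theorem exists_eq_meet (t : Tree h) : ∃ a b, t = meet h a b := by
  induction t using Antisymmetrization.ind with
  | _ p => exact ⟨p.1, p.2, rfl⟩

theorem meet_le_meet_iff {a b x y : M} :
    meet h a b ≤ meet h x y ↔ ¬ C x a b ∧ ¬ C y a b := Iff.rfl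

theorem meet_le_leaf_iff {a b x : M} : meet h a b ≤ leaf h x ↔ ¬ C x a b :=
  ⟨fun H => H.1, fun H => ⟨H, H⟩⟩

theorem rel_iff {x y z : M} : C x y z ↔ ¬ meet h y z ≤ leaf h x := by
  rw [meet_le_leaf_iff, not_not]

theorem le_meet_iff {t : Tree h} {x y : M} :
    t ≤ meet h x y ↔ t ≤ leaf h x ∧ t ≤ leaf h y := by
  obtain ⟨a, b, rfl⟩ := exists_eq_meet h t
  rw [meet_le_leaf_iff, meet_le_leaf_iff, meet_le_meet_iff]

theorem meet_le_left (x y : M) : meet h x y ≤ leaf h x := ((le_meet_iff h).1 le_rfl).1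

theorem meet_le_right (x y : M) : meet h x y ≤ leaf h y := ((le_meet_iff h).1 le_rfl).2

theorem meet_comm (x y : M) : meet h x y = meet h y x :=
  le_antisymm ((le_meet_iff h).2 ⟨meet_le_right h x y, meet_le_left h x y⟩)
    ((le_meet_iff h).2 ⟨meet_le_right h y x, meet_le_left h y x⟩)

variable {h}

/-- If a ∧ b and c ∧ d are incomparable, some e ∈ {c, d} satisfies C(e, a, b) and some f ∈ {a, b}
satisfies C(f, c, d). As both nodes lie below x, this becomes C(e, f, x) and C(f, e, x), against
asymmetry. -/
theorem le_total_of_le_leaf {s t : Tree h} {x : M} (hs : s ≤ leaf h x) (ht : t ≤ leaf h x) :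
    s ≤ t ∨ t ≤ s := by
  obtain ⟨a, b, rfl⟩ := exists_eq_meet h s
  obtain ⟨c, d, rfl⟩ := exists_eq_meet h t
  rw [meet_le_leaf_iff] at hs ht
  by_contra! hcon
  obtain ⟨h1, h2⟩ := hcon
  rw [meet_le_meet_iff] at h1 h2
  have key : ∀ e, C e a b → C e a x := fun e he => (h.trans _ _ _ x he).resolve_right hs
  have key' : ∀ e, C e a b → C e b x := fun e he =>
    (h.trans _ _ _ x (h.symm _ _ _ he)).resolve_right fun H => hs (h.symm _ _ _ H)
  have key2 : ∀ e, C e c d → C e c x := fun e he => (h.trans _ _ _ x he).resolve_right ht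
  have key2' : ∀ e, C e c d → C e d x := fun e he =>
    (h.trans _ _ _ x (h.symm _ _ _ he)).resolve_right fun H => ht (h.symm _ _ _ H)
  have fin : ∀ e f, C e f x → C f e x → False := fun e f h1 h2 =>
    h.asymm _ _ _ (h.symm _ _ _ h1) (by
      have := h.asymm _ _ _ h1
      exact absurd h2 this)
  rcases not_and_or.1 h1 with h1 | h1 <;> rcases not_and_or.1 h2 with h2 | h2 <;>
    rw [not_not] at h1 h2
  · exact fin _ _ (key _ h1) (key2 _ h2)
  · exact fin _ _ (key' _ h1) (key2 _ h2)
  · exact fin _ _ (key _ h1) (key2' _ h2)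
  · exact fin _ _ (key' _ h1) (key2' _ h2)

theorem le_total_of_le {s t r : Tree h} (hs : s ≤ r) (ht : t ≤ r) : s ≤ t ∨ t ≤ s := by
  obtain ⟨a, b, rfl⟩ := exists_eq_meet h r
  exact le_total_of_le_leaf (hs.trans (meet_le_left h a b)) (ht.trans (meet_le_left h a b))

theorem lt_of_not_le_leaf {s t : Tree h} {x : M} (hs : s ≤ leaf h x) (ht : t ≤ leaf h x)
    (hst : ¬ s ≤ t) : t < s :=
  lt_of_le_not_ge ((le_total_of_le_leaf hs ht).resolve_left hst) hst

theorem lt_of_not_le {s t r : Tree h} (hs : s ≤ r) (ht : t ≤ r) (hst : ¬ s ≤ t) : t < s :=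
  lt_of_le_not_ge ((le_total_of_le hs ht).resolve_left hst) hst

theorem exists_le_leaf (t : Tree h) : ∃ x, t ≤ leaf h x := by
  obtain ⟨a, b, rfl⟩ := exists_eq_meet h t
  exact ⟨a, meet_le_left h a b⟩

/-- Every node below the leaf of `x` is of the form `y ∧ x`. -/
theorem exists_meet_eq {t : Tree h} {x : M} (ht : t ≤ leaf h x) : ∃ y, meet h y x = t := by
  obtain ⟨a, b, rfl⟩ := exists_eq_meet h t
  rcases le_total_of_le_leaf (meet_le_right h a x) (meet_le_right h b x) with h1 | h1
  · exact ⟨a, le_antisymm ((le_meet_iff h).2 ⟨meet_le_left h a x, h1.trans (meet_le_left h b x)⟩)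
      ((le_meet_iff h).2 ⟨meet_le_left h a b, ht⟩)⟩
  · exact ⟨b, le_antisymm ((le_meet_iff h).2 ⟨h1.trans (meet_le_left h a x), meet_le_left h b x⟩)
      ((le_meet_iff h).2 ⟨meet_le_right h a b, ht⟩)⟩

theorem leaf_injective {x y : M} (hxy : leaf h x ≤ leaf h y) : x = y := by
  by_contra hne
  exact (meet_le_leaf_iff h).1 hxy (h.ne y x (Ne.symm hne))

/-- If a node lies below the leaves of `x` and `y` but not below that of `f`, then `f` branches off
from `x` and `y` at the same node. -/
theorem meet_eq_meet_of_not_le {t : Tree h} {x y f : M} (hx : t ≤ leaf h x) (hy : t ≤ leaf h y)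
    (hf : ¬ t ≤ leaf h f) : meet h f x = meet h f y := by
  have key : ∀ {x y}, t ≤ leaf h x → t ≤ leaf h y → meet h f x ≤ meet h f y := fun {x y} hx hy => by
    rcases le_total_of_le_leaf (meet_le_right h f x) hx with h1 | h1
    · exact (le_meet_iff h).2 ⟨meet_le_left h f x, h1.trans hy⟩
    · exact absurd (h1.trans (meet_le_left h f x)) hf
  exact le_antisymm (key hx hy) (key hy hx)

theorem meet_eq_meet_of_lt {x y f : M} (hlt : meet h f x < meet h x y) :
    meet h f y = meet h f x :=
  (meet_eq_meet_of_not_le (meet_le_left h x y) (meet_le_right h x y) fun H =>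
    hlt.not_ge ((le_meet_iff h).2 ⟨H, meet_le_left h x y⟩)).symm

/-- Typically `Φ` consists of the nodes where finitely many parameters branch off from a fixed
element. Having no greatest element, the chain can be followed past all those that it bounds, and
from `w` on it meets none. -/
theorem exists_lt_of_finite {Z : Set (Tree h)} (hZ : ∀ a ∈ Z, ∀ b ∈ Z, a ≤ b ∨ b ≤ a)
    (hne : Z.Nonempty) (hmax : ∀ z ∈ Z, ∃ z' ∈ Z, z < z') {Φ : Set (Tree h)} (hΦ : Φ.Finite) :
    ∃ w ∈ Z, ∀ φ ∈ Φ, (∃ z ∈ Z, φ ≤ z) → φ < w := by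
  induction Φ, hΦ using Set.Finite.induction_on with
  | empty => obtain ⟨z, hz⟩ := hne; exact ⟨z, hz, by simp⟩
  | @insert a s _ _ ih =>
    obtain ⟨w, hw, hs⟩ := ih
    by_cases ha : ∃ z ∈ Z, a ≤ z
    · obtain ⟨z, hz, haz⟩ := ha
      obtain ⟨z', hz', hlt⟩ := hmax z hz
      rcases hZ _ hw _ hz' with h1 | h1
      · refine ⟨z', hz', ?_⟩
        rintro φ (rfl | hφ) hφz
        · exact haz.trans_lt hlt
        · exact (hs φ hφ hφz).trans_le h1
      · refine ⟨w, hw, ?_⟩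
        rintro φ (rfl | hφ) hφz
        · exact (haz.trans_lt hlt).trans_le h1
        · exact hs φ hφ hφz
    · refine ⟨w, hw, ?_⟩
      rintro φ (rfl | hφ) hφz
      · exact absurd hφz ha
      · exact hs φ hφ hφz

theorem exists_gt_of_finite {Z : Set (Tree h)} (hZ : ∀ a ∈ Z, ∀ b ∈ Z, a ≤ b ∨ b ≤ a)
    (hne : Z.Nonempty) (hmin : ∀ z ∈ Z, ∃ z' ∈ Z, z' < z) {Φ : Set (Tree h)} (hΦ : Φ.Finite) :
    ∃ w ∈ Z, ∀ φ ∈ Φ, (∃ z ∈ Z, z ≤ φ) → w < φ := by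
  induction Φ, hΦ using Set.Finite.induction_on with
  | empty => obtain ⟨z, hz⟩ := hne; exact ⟨z, hz, by simp⟩
  | @insert a s _ _ ih =>
    obtain ⟨w, hw, hs⟩ := ih
    by_cases ha : ∃ z ∈ Z, z ≤ a
    · obtain ⟨z, hz, haz⟩ := ha
      obtain ⟨z', hz', hlt⟩ := hmin z hz
      rcases hZ _ hz' _ hw with h1 | h1
      · refine ⟨z', hz', ?_⟩
        rintro φ (rfl | hφ) hφz
        · exact hlt.trans_le haz
        · exact h1.trans_lt (hs φ hφ hφz)
      · refine ⟨w, hw, ?_⟩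
        rintro φ (rfl | hφ) hφz
        · exact h1.trans_lt (hlt.trans_le haz)
        · exact hs φ hφ hφz
    · refine ⟨w, hw, ?_⟩
      rintro φ (rfl | hφ) hφz
      · exact absurd hφz ha
      · exact hs φ hφ hφz

/-- Nodes below one leaf form a chain, so each `f ∈ F` accounts for at most one node satisfying `Θ`.
-/
theorem finite_of_subsingleton_below {Θ : Tree h → Prop} {F : Set M} (hF : F.Finite)
    (hex : ∀ t, Θ t → ∃ f ∈ F, t ≤ leaf h f) (hsub : ∀ s t, Θ s → Θ t → s ≤ t → s = t) :
    {t | Θ t}.Finite := by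
  refine (hF.biUnion (t := fun f => {t | Θ t ∧ t ≤ leaf h f}) fun f _ => ?_).subset ?_
  · refine Set.Subsingleton.finite fun s hs t ht => ?_
    rcases le_total_of_le_leaf hs.2 ht.2 with H | H
    · exact hsub s t hs.1 ht.1 H
    · exact (hsub t s ht.1 hs.1 H).symm
  · intro t ht
    obtain ⟨f, hf, hle⟩ := hex t ht
    exact Set.mem_biUnion hf ⟨ht, hle⟩

end Tree

/-! ## Quantifier free definability in the pure language -/

section QF

variable {N : Type w} {C : N → N → N → Prop}

/-- The elements `x` and `y` have the same quantifier free type over `F` in the language `{C}`. -/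
def SameQF (C : N → N → N → Prop) (F : Set N) (x y : N) : Prop :=
  ∀ i j k : N ⊕ Unit, (∀ n, i = Sum.inl n → n ∈ F) → (∀ n, j = Sum.inl n → n ∈ F) →
    (∀ n, k = Sum.inl n → n ∈ F) →
    ((Sum.elim id (fun _ => x) i : N) = Sum.elim id (fun _ => x) j ↔
      (Sum.elim id (fun _ => y) i : N) = Sum.elim id (fun _ => y) j) ∧
    (C (Sum.elim id (fun _ => x) i) (Sum.elim id (fun _ => x) j) (Sum.elim id (fun _ => x) k) ↔
      C (Sum.elim id (fun _ => y) i) (Sum.elim id (fun _ => y) j) (Sum.elim id (fun _ => y) k))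

theorem SameQF.mono {F G : Set N} (hFG : F ⊆ G) {x y : N} (hxy : SameQF C G x y) :
    SameQF C F x y := fun i j k hi hj hk =>
  hxy i j k (fun n hn => hFG (hi n hn)) (fun n hn => hFG (hj n hn)) (fun n hn => hFG (hk n hn))

theorem pure_term_eq_var {n : ℕ} (t : pureLanguage.Term ((N ⊕ Unit) ⊕ Fin n)) :
    ∃ m, t = Language.Term.var m := by
  cases t with
  | var m => exact ⟨m, rfl⟩
  | func f _ => exact Empty.elim f

/-- The parameters occurring in the formula suffice for `F`. Together with
`isQFDefinable_of_finite`, this replaces syntax by finite parameter sets. -/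
theorem IsQFDefinable.exists_finite {S : Set N} (hS : IsQFDefinable C S) :
    ∃ F : Set N, F.Finite ∧ ∀ x y, SameQF C F x y → (x ∈ S ↔ y ∈ S) := by
  obtain ⟨φ, hφ, rfl⟩ := hS
  let _ := pureStructure C
  have hvar : ∀ t : pureLanguage.Term ((N ⊕ Unit) ⊕ Fin 0), ∃ m : N ⊕ Unit,
      t = Language.Term.var (Sum.inl m) := fun t => by
    obtain ⟨m | m, rfl⟩ := pure_term_eq_var t
    · exact ⟨m, rfl⟩
    · exact m.elim0
  have key : ∃ F : Set N, F.Finite ∧ ∀ x y, SameQF C F x y →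
      (Language.BoundedFormula.Realize φ (Sum.elim id (fun _ => x)) default ↔
        Language.BoundedFormula.Realize φ (Sum.elim id (fun _ => y)) default) := by
    induction hφ with
    | falsum => exact ⟨∅, Set.finite_empty, fun _ _ _ => Iff.rfl⟩
    | of_isAtomic h =>
      have hfin : ∀ m : N ⊕ Unit, {n | m = Sum.inl n}.Finite := fun m =>
        Set.Subsingleton.finite fun a ha b hb => Sum.inl_injective (ha.symm.trans hb)
      cases h with
      | equal t₁ t₂ =>
        obtain ⟨i, rfl⟩ := hvar t₁
        obtain ⟨j, rfl⟩ := hvar t₂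
        refine ⟨{n | i = Sum.inl n} ∪ {n | j = Sum.inl n}, (hfin i).union (hfin j),
          fun x y hxy => ?_⟩
        simpa using (hxy i j j (fun n hn => Or.inl hn) (fun n hn => Or.inr hn)
          (fun n hn => Or.inr hn)).1
      | @rel l R ts =>
        cases R
        choose m hm using fun i => hvar (ts i)
        refine ⟨{n | m 0 = Sum.inl n} ∪ {n | m 1 = Sum.inl n} ∪ {n | m 2 = Sum.inl n},
          ((hfin _).union (hfin _)).union (hfin _), fun x y hxy => ?_⟩
        have := (hxy (m 0) (m 1) (m 2) (fun n hn => Or.inl (Or.inl hn))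
          (fun n hn => Or.inl (Or.inr hn)) (fun n hn => Or.inr hn)).2
        have e : ∀ z : N, Language.BoundedFormula.Realize
            (Language.BoundedFormula.rel (L := pureLanguage) PureSymbol.C ts)
            (Sum.elim id (fun _ => z)) default ↔ C (Sum.elim id (fun _ => z) (m 0))
              (Sum.elim id (fun _ => z) (m 1)) (Sum.elim id (fun _ => z) (m 2)) := fun z => by
          change C ((ts 0).realize _) ((ts 1).realize _) ((ts 2).realize _) ↔ _
          rw [hm 0, hm 1, hm 2]
          rfl
        exact (e x).trans (this.trans (e y).symm)
    | imp _ _ ih₁ ih₂ =>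
      obtain ⟨F, hF, h1⟩ := ih₁
      obtain ⟨G, hG, h2⟩ := ih₂
      refine ⟨F ∪ G, hF.union hG, fun x y hxy => ?_⟩
      rw [Language.BoundedFormula.realize_imp, Language.BoundedFormula.realize_imp,
        h1 x y (hxy.mono Set.subset_union_left), h2 x y (hxy.mono Set.subset_union_right)]
  exact key

theorem IsQFDefinable.compl {S : Set N} (hS : IsQFDefinable C S) : IsQFDefinable C Sᶜ := by
  obtain ⟨φ, hφ, rfl⟩ := hS
  exact ⟨φ.not, hφ.not, rfl⟩

theorem IsQFDefinable.inter {S T : Set N} (hS : IsQFDefinable C S) (hT : IsQFDefinable C T) :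
    IsQFDefinable C (S ∩ T) := by
  obtain ⟨φ, hφ, rfl⟩ := hS
  obtain ⟨ψ, hψ, rfl⟩ := hT
  refine ⟨φ ⊓ ψ, hφ.inf hψ, ?_⟩
  ext x
  exact (let _ := pureStructure C; Language.Formula.realize_inf.symm)

theorem isQFDefinable_univ : IsQFDefinable C (Set.univ : Set N) := by
  refine ⟨⊤, Language.BoundedFormula.IsQF.top, ?_⟩
  ext x
  let _ := pureStructure C
  simp [Language.Formula.realize_top]

theorem IsQFDefinable.biInter {α : Type*} {I : Set α} (hI : I.Finite) {S : α → Set N}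
    (hS : ∀ i ∈ I, IsQFDefinable C (S i)) : IsQFDefinable C (⋂ i ∈ I, S i) := by
  induction I, hI using Set.Finite.induction_on with
  | empty => simpa using isQFDefinable_univ
  | insert _ _ ih =>
    rw [Set.biInter_insert]
    exact (hS _ (Set.mem_insert _ _)).inter (ih fun i hi => hS i (Set.mem_insert_of_mem _ hi))

theorem IsQFDefinable.biUnion {α : Type*} {I : Set α} (hI : I.Finite) {S : α → Set N}
    (hS : ∀ i ∈ I, IsQFDefinable C (S i)) : IsQFDefinable C (⋃ i ∈ I, S i) := by
  have := (IsQFDefinable.biInter hI fun i hi => (hS i hi).compl).compl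
  simpa [Set.compl_iInter] using this

theorem isQFDefinable_eq (i j : N ⊕ Unit) : IsQFDefinable C
    {x : N | (Sum.elim id (fun _ => x) i : N) = Sum.elim id (fun _ => x) j} := by
  refine ⟨(Language.Term.var i).equal (Language.Term.var j),
    (Language.BoundedFormula.IsAtomic.equal _ _).isQF, ?_⟩
  ext x
  let _ := pureStructure C
  simp [Language.Formula.realize_equal]

theorem isQFDefinable_rel (i j k : N ⊕ Unit) : IsQFDefinable C
    {x : N | C (Sum.elim id (fun _ => x) i) (Sum.elim id (fun _ => x) j)
      (Sum.elim id (fun _ => x) k)} := by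
  refine ⟨Language.Relations.formula (L := pureLanguage) PureSymbol.C
    ![Language.Term.var i, Language.Term.var j, Language.Term.var k],
    (Language.BoundedFormula.IsAtomic.rel _ _).isQF, ?_⟩
  rfl

theorem IsQFDefinable.iff_const {S : Set N} (hS : IsQFDefinable C S) (p : Prop) :
    IsQFDefinable C {x | p ↔ x ∈ S} := by
  by_cases hp : p
  · simpa [hp] using hS
  · simpa [hp] using! hS.compl

/-- There are finitely many atomic formulas over `F`, hence finitely many truth tables `T x`. Each
fibre of `T` is a finite intersection of definable sets, and `S` is a finite union of fibres. -/
theorem isQFDefinable_of_finite {S F : Set N} (hF : F.Finite)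
    (hS : ∀ x y, SameQF C F x y → (x ∈ S ↔ y ∈ S)) : IsQFDefinable C S := by
  let I : Set (N ⊕ Unit) := {i | ∀ n, i = Sum.inl n → n ∈ F}
  have hI : I.Finite := by
    refine ((hF.image Sum.inl).union (Set.finite_singleton (Sum.inr ()))).subset ?_
    rintro (n | n) hn
    · exact Or.inl ⟨n, hn n rfl, rfl⟩
    · exact Or.inr rfl
  have hI₃ := hI.prod (hI.prod hI)
  have := hI₃.to_subtype
  let T : N → ↑(I ×ˢ (I ×ˢ I)) → Prop × Prop := fun x a =>
    ((Sum.elim id (fun _ => x) a.1.1 : N) = Sum.elim id (fun _ => x) a.1.2.1,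
     C (Sum.elim id (fun _ => x) a.1.1) (Sum.elim id (fun _ => x) a.1.2.1)
      (Sum.elim id (fun _ => x) a.1.2.2))
  have hT : ∀ x y, T x = T y ↔ SameQF C F x y := by
    intro x y
    rw [funext_iff]
    constructor
    · intro H i j k hi hj hk
      have := H ⟨(i, j, k), hi, hj, hk⟩
      exact ⟨iff_of_eq (congrArg Prod.fst this), iff_of_eq (congrArg Prod.snd this)⟩
    · rintro H ⟨⟨i, j, k⟩, hi, hj, hk⟩
      have := H i j k hi hj hk
      exact Prod.ext (propext this.1) (propext this.2)
  have hfib : ∀ x, IsQFDefinable C {y | SameQF C F x y} := by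
    intro x
    have h1 := IsQFDefinable.biInter hI₃ (S := fun a : (N ⊕ Unit) × (N ⊕ Unit) × (N ⊕ Unit) =>
      {y | (Sum.elim id (fun _ => x) a.1 : N) = Sum.elim id (fun _ => x) a.2.1 ↔
        y ∈ {y : N | (Sum.elim id (fun _ => y) a.1 : N) = Sum.elim id (fun _ => y) a.2.1}} ∩
      {y | C (Sum.elim id (fun _ => x) a.1) (Sum.elim id (fun _ => x) a.2.1)
        (Sum.elim id (fun _ => x) a.2.2) ↔
        y ∈ {y : N | C (Sum.elim id (fun _ => y) a.1) (Sum.elim id (fun _ => y) a.2.1)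
        (Sum.elim id (fun _ => y) a.2.2)}})
      (fun a _ => ((isQFDefinable_eq _ _).iff_const _).inter ((isQFDefinable_rel _ _ _).iff_const _))
    convert h1 using 1
    ext y
    simp only [Set.mem_iInter]
    exact ⟨fun H a ha => H a.1 a.2.1 a.2.2 ha.1 ha.2.1 ha.2.2,
      fun H i j k hi hj hk => H (i, j, k) ⟨hi, hj, hk⟩⟩
  have h2 := IsQFDefinable.biUnion (Set.toFinite (T '' S)) (S := fun τ => {y | T y = τ})
    (by
      rintro _ ⟨x, -, rfl⟩
      convert hfib x using 1
      ext y
      rw [Set.mem_ofPred_eq, Set.mem_ofPred_eq, ← hT, eq_comm])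
  convert h2 using 1
  ext y
  simp only [Set.mem_iUnion, Set.mem_image, Set.mem_ofPred_eq]
  constructor
  · exact fun hy => ⟨T y, ⟨y, hy, rfl⟩, rfl⟩
  · rintro ⟨_, ⟨x, hx, rfl⟩, hxy⟩
    exact (hS y x ((hT y x).1 hxy)).2 hx

/-- The other atomic formulas reduce to these two kinds: x = f means ¬C(x, f, f), the last two
arguments of C commute, and repeated arguments make C false or an inequality. -/
theorem IsCRelation.sameQF (h : IsCRelation C) {F : Set N} {x y : N}
    (h1 : ∀ f ∈ F, ∀ g ∈ F, C x f g ↔ C y f g) (h2 : ∀ f ∈ F, ∀ g ∈ F, C f x g ↔ C f y g) :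
    SameQF C F x y := by
  have irr : ∀ a b, ¬ C a a b := fun a b H => h.asymm _ _ _ H H
  have irr' : ∀ a b, ¬ C a b a := fun a b H => irr a b (h.symm _ _ _ H)
  have eq_iff : ∀ f ∈ F, x = f ↔ y = f := by
    intro f hf
    have : ∀ a, a = f ↔ ¬ C a f f := fun a =>
      ⟨by rintro rfl; exact irr _ _, fun H => by_contra fun hne => H (h.ne _ _ hne)⟩
    rw [this, this, h1 f hf f hf]
  have comm : ∀ a b d, C a b d ↔ C a d b := fun a b d => ⟨h.symm _ _ _, h.symm _ _ _⟩
  have ne_iff : ∀ a b, C a b b ↔ a ≠ b := fun a b =>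
    ⟨by rintro H rfl; exact irr _ _ H, h.ne _ _⟩
  rintro (i | i) (j | j) (k | k) hi hj hk <;> simp only [Sum.elim_inl, Sum.elim_inr, id_eq,
    Sum.inl.injEq, forall_eq'] at hi hj hk ⊢
  · exact ⟨trivial, trivial⟩
  · exact ⟨trivial, by rw [comm, h2 i hi j hj, comm]⟩
  · exact ⟨by rw [eq_comm, eq_iff i hi, eq_comm], h2 i hi k hk⟩
  · exact ⟨by rw [eq_comm, eq_iff i hi, eq_comm], by
      rw [ne_iff, ne_iff, ne_comm, ne_eq, eq_iff i hi, ne_comm]⟩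
  · exact ⟨eq_iff j hj, h1 j hj k hk⟩
  · exact ⟨eq_iff j hj, iff_of_false (irr' _ _) (irr' _ _)⟩
  · exact ⟨by simp, iff_of_false (irr _ _) (irr _ _)⟩
  · exact ⟨by simp, iff_of_false (irr _ _) (irr _ _)⟩

/-- Elements that branch off from all elements of `F` at the same nodes have the same type. -/
theorem sameQF_of_meet_eq (h : IsCRelation C) {F : Set N} {x y : N}
    (hxy : ∀ f ∈ F, meet h f x = meet h f y) : SameQF C F x y := by
  refine h.sameQF (fun f hf g _ => ?_) (fun f hf g hg => ?_)
  · rw [rel_iff h, rel_iff h, not_iff_not]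
    have : ∀ z, meet h f g ≤ leaf h z ↔ meet h f g ≤ meet h f z := fun z => by
      rw [le_meet_iff]; exact ⟨fun H => ⟨meet_le_left h f g, H⟩, And.right⟩
    rw [this, this, hxy f hf]
  · rw [rel_iff h, rel_iff h, meet_comm h x, meet_comm h y, hxy g hg]

/-- Elements that branch off from `β` in an interval containing no node `f ∧ β`, `f ∈ F`, have
the same type. -/
theorem sameQF_of_interval (h : IsCRelation C) {F : Set N} {x y β : N}
    (hle : meet h x β ≤ meet h y β)
    (hno : ∀ f ∈ F, meet h x β ≤ meet h f β → ¬ meet h f β ≤ meet h y β) : SameQF C F x y := by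
  set s := meet h x β with hs
  set s' := meet h y β with hs'
  -- Each `f` leaves the branch of `β` below both `s` and `s'` or above both. A low `f` sees `x` and
  -- `y` leave at the same node. A high one sees `s` and `s'`, possibly different, but no node
  -- coming from `F` separates them.
  have cases : ∀ f ∈ F, meet h f β < s ∨ s' < meet h f β := by
    intro f hf
    by_cases h1 : s ≤ meet h f β
    · exact Or.inr (lt_of_not_le_leaf (meet_le_right h f β) (meet_le_right h y β) (hno f hf h1))
    · exact Or.inl (lt_of_not_le_leaf (meet_le_right h x β) (meet_le_right h f β) h1)
  have low : ∀ f, meet h f β < s → meet h f x = meet h f β ∧ meet h f y = meet h f β := by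
    intro f hf
    refine ⟨meet_eq_meet_of_lt (by rwa [meet_comm h β x]), meet_eq_meet_of_lt ?_⟩
    rw [meet_comm h β y]
    exact hf.trans_le hle
  have high : ∀ f, s' < meet h f β → meet h f x = s ∧ meet h f y = s' := by
    intro f hf
    rw [meet_comm h f β] at hf
    refine ⟨?_, ?_⟩
    · rw [meet_comm h f x]
      exact meet_eq_meet_of_lt (hle.trans_lt hf)
    · rw [meet_comm h f y]
      exact meet_eq_meet_of_lt hf
  refine h.sameQF (fun f hf g hg => ?_) (fun f hf g hg => ?_)
  · rw [rel_iff h, rel_iff h, not_iff_not]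
    have e : ∀ z, meet h f g ≤ leaf h z ↔ meet h f g ≤ meet h f z := fun z => by
      rw [le_meet_iff]; exact ⟨fun H => ⟨meet_le_left h f g, H⟩, And.right⟩
    have e' : ∀ z, meet h f g ≤ leaf h z ↔ meet h f g ≤ meet h g z := fun z => by
      rw [le_meet_iff]; exact ⟨fun H => ⟨meet_le_right h f g, H⟩, And.right⟩
    rcases cases f hf with h1 | h1
    · rw [e, e, (low f h1).1, (low f h1).2]
    rcases cases g hg with h2 | h2
    · rw [e', e', (low g h2).1, (low g h2).2]
    have h3 : s' < meet h f g := by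
      rcases le_total_of_le_leaf (meet_le_right h f β) (meet_le_right h g β) with h4 | h4
      · exact h1.trans_le ((le_meet_iff h).2 ⟨meet_le_left h f β, h4.trans (meet_le_left h g β)⟩)
      · exact h2.trans_le ((le_meet_iff h).2 ⟨h4.trans (meet_le_left h f β), meet_le_left h g β⟩)
    rw [e, e, (high f h1).1, (high f h1).2]
    exact iff_of_false (hle.trans_lt h3).not_ge h3.not_ge
  · rw [rel_iff h, rel_iff h, not_iff_not, meet_comm h x, meet_comm h y]
    have e : ∀ z, meet h g z ≤ leaf h f ↔ meet h g z ≤ meet h f z := fun z => by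
      rw [le_meet_iff]; exact ⟨fun H => ⟨H, meet_le_right h g z⟩, And.left⟩
    rw [e, e]
    rcases cases f hf with h1 | h1 <;> rcases cases g hg with h2 | h2
    · rw [(low f h1).1, (low f h1).2, (low g h2).1, (low g h2).2]
    · rw [(low f h1).1, (low f h1).2, (high g h2).1, (high g h2).2]
      exact iff_of_false h1.not_ge (h1.trans_le hle).not_ge
    · rw [(high f h1).1, (high f h1).2, (low g h2).1, (low g h2).2]
      exact iff_of_true h2.le (h2.le.trans hle)
    · rw [(high f h1).1, (high f h1).2, (high g h2).1, (high g h2).2]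
      exact iff_of_true le_rfl le_rfl

end QF

/-! ## Definable predicates -/

section Dfn

variable {L : FirstOrder.Language.{u, v}} {M : Type w} [L.Structure M] {ι κ : Type*}

/-- The predicate `R` on tuples is definable without parameters. -/
def Dfn (L : FirstOrder.Language.{u, v}) {M : Type w} [L.Structure M] {ι : Type*}
    (R : (ι → M) → Prop) : Prop :=
  ∃ φ : L.Formula ι, ∀ v, φ.Realize v ↔ R v

theorem Dfn.same {R : (ι → M) → Prop} (hR : Dfn L R) {p q : ι → M} (hpq : Same L p q) :
    R p ↔ R q := by
  obtain ⟨φ, hφ⟩ := hR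
  rw [← hφ, ← hφ]
  exact hpq φ

theorem Dfn.not {R : (ι → M) → Prop} (hR : Dfn L R) : Dfn L fun v => ¬ R v := by
  obtain ⟨φ, hφ⟩ := hR
  exact ⟨φ.not, fun v => by rw [Language.Formula.realize_not, hφ]⟩

theorem Dfn.and {R S : (ι → M) → Prop} (hR : Dfn L R) (hS : Dfn L S) :
    Dfn L fun v => R v ∧ S v := by
  obtain ⟨φ, hφ⟩ := hR
  obtain ⟨ψ, hψ⟩ := hS
  exact ⟨φ ⊓ ψ, fun v => by rw [Language.Formula.realize_inf, hφ, hψ]⟩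

theorem Dfn.imp {R S : (ι → M) → Prop} (hR : Dfn L R) (hS : Dfn L S) :
    Dfn L fun v => R v → S v := by
  obtain ⟨φ, hφ⟩ := hR
  obtain ⟨ψ, hψ⟩ := hS
  exact ⟨φ.imp ψ, fun v => by rw [Language.Formula.realize_imp, hφ, hψ]⟩

theorem Dfn.exTuple [Finite κ] {R : (ι → M) → (κ → M) → Prop}
    (hR : Dfn L fun q : ι ⊕ κ → M => R (fun i => q (Sum.inl i)) (fun k => q (Sum.inr k))) :
    Dfn L fun v => ∃ a, R v a := by
  obtain ⟨φ, hφ⟩ := hR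
  refine ⟨φ.iExs κ, fun v => ?_⟩
  rw [Language.Formula.realize_iExs]
  exact exists_congr fun a => hφ _

theorem Dfn.ex {R : (ι → M) → M → Prop}
    (hR : Dfn L fun q : ι ⊕ Unit → M => R (fun i => q (Sum.inl i)) (q (Sum.inr ()))) :
    Dfn L fun v => ∃ a, R v a := by
  obtain ⟨φ, hφ⟩ := Dfn.exTuple (κ := Unit) (R := fun v a => R v (a ())) hR
  exact ⟨φ, fun v => (hφ v).trans
    ⟨fun ⟨a, ha⟩ => ⟨a (), ha⟩, fun ⟨a, ha⟩ => ⟨fun _ => a, ha⟩⟩⟩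

theorem Dfn.all {R : (ι → M) → M → Prop}
    (hR : Dfn L fun q : ι ⊕ Unit → M => R (fun i => q (Sum.inl i)) (q (Sum.inr ()))) :
    Dfn L fun v => ∀ a, R v a := by
  obtain ⟨φ, hφ⟩ := (Dfn.ex (R := fun v a => ¬ R v a) hR.not).not
  exact ⟨φ, fun v => (hφ v).trans (by push Not; rfl)⟩

theorem Dfn.mem {A : Set M} (hA : (∅ : Set M).Definable₁ L A) (i : ι) :
    Dfn L fun v : ι → M => v i ∈ A := by
  obtain ⟨φ, hφ⟩ := Set.empty_definable_iff.1 hA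
  refine ⟨φ.relabel (fun _ => i), fun v => ?_⟩
  rw [Language.Formula.realize_relabel]
  exact (Set.ext_iff.1 hφ (v ∘ fun _ => i)).symm

theorem Dfn.rel (c : L.Relations 3) (i j k : ι) :
    Dfn L fun v : ι → M => crel c M (v i) (v j) (v k) := by
  refine ⟨c.formula ![Language.Term.var i, Language.Term.var j, Language.Term.var k], fun v => ?_⟩
  rw [Language.Formula.realize_rel]
  change _ ↔ Language.Structure.RelMap c _
  apply iff_of_eq
  congr 1
  funext i
  fin_cases i <;> rfl

variable {c : L.Relations 3} {h : IsCRelation (crel c M)}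

theorem Dfn.le (i j k l : ι) :
    Dfn L fun v : ι → M => meet h (v i) (v j) ≤ meet h (v k) (v l) :=
  (Dfn.rel c k i j).not.and (Dfn.rel c l i j).not

theorem Dfn.lt (i j k l : ι) :
    Dfn L fun v : ι → M => meet h (v i) (v j) < meet h (v k) (v l) := by
  simp only [lt_iff_le_not_ge]
  exact (Dfn.le i j k l).and (Dfn.le k l i j).not

theorem Dfn.eq (i j k l : ι) :
    Dfn L fun v : ι → M => meet h (v i) (v j) = meet h (v k) (v l) := by
  simp only [le_antisymm_iff]
  exact (Dfn.le i j k l).and (Dfn.le k l i j)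

theorem Dfn.leLeaf (i j k : ι) :
    Dfn L fun v : ι → M => meet h (v i) (v j) ≤ leaf h (v k) := Dfn.le i j k k

/-- Nodes are meets of two elements, so a quantifier over nodes is a pair of quantifiers over
elements. -/
theorem Dfn.exTree {R : (ι → M) → Tree h → Prop}
    (hR : Dfn L fun q : ι ⊕ Fin 2 → M =>
      R (fun i => q (Sum.inl i)) (meet h (q (Sum.inr 0)) (q (Sum.inr 1)))) :
    Dfn L fun v => ∃ t, R v t := by
  obtain ⟨φ, hφ⟩ := Dfn.exTuple (κ := Fin 2) (R := fun v a => R v (meet h (a 0) (a 1))) hR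
  refine ⟨φ, fun v => (hφ v).trans ⟨fun ⟨a, ha⟩ => ⟨_, ha⟩, ?_⟩⟩
  rintro ⟨t, ht⟩
  obtain ⟨a, b, rfl⟩ := exists_eq_meet h t
  exact ⟨![a, b], ht⟩

theorem Dfn.allTree {R : (ι → M) → Tree h → Prop}
    (hR : Dfn L fun q : ι ⊕ Fin 2 → M =>
      R (fun i => q (Sum.inl i)) (meet h (q (Sum.inr 0)) (q (Sum.inr 1)))) :
    Dfn L fun v => ∀ t, R v t := by
  obtain ⟨φ, hφ⟩ := (Dfn.exTree (R := fun v a => ¬ R v a) hR.not).not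
  exact ⟨φ, fun v => (hφ v).trans (by push Not; rfl)⟩

/-- In a `C`-minimal structure definable sets are quantifier free definable in `{C}`. -/
theorem IsCMinimal.exists_finite (hM : IsCMinimal c M) {R : (ι ⊕ Unit → M) → Prop}
    (hR : Dfn L R) (p : ι → M) : ∃ F : Set M, F.Finite ∧ ∀ x y, SameQF (crel c M) F x y →
      (R (Sum.elim p fun _ => x) ↔ R (Sum.elim p fun _ => y)) := by
  obtain ⟨φ, hφ⟩ := hR
  refine (hM.2 M rfl {x | R (Sum.elim p fun _ => x)} ?_).exists_finite
  refine Set.definable_iff_exists_formula_sum.2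
    ⟨φ.relabel (Sum.map (fun i => ⟨p i, trivial⟩) (fun _ => 0)), ?_⟩
  ext x
  rw [Set.mem_ofPred_eq, Set.mem_ofPred_eq, Set.mem_ofPred_eq, Language.Formula.realize_relabel,
    ← hφ]
  refine iff_of_eq (congrArg _ (funext ?_))
  rintro (i | i) <;> rfl

/-- A set defined by a node of the canonical tree, when the node lies in a finite definable set
of nodes, is definable over `acl(∅)`. -/
theorem isAclDefinable_of_finite {Θ : Tree h → Prop} {Ψ : Tree h → M → Prop}
    (hΘ : Dfn L fun v : Fin 2 → M => Θ (meet h (v 0) (v 1)))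
    (hΨ : Dfn L fun v : Fin 2 ⊕ Unit → M =>
      Ψ (meet h (v (Sum.inl 0)) (v (Sum.inl 1))) (v (Sum.inr ())))
    (hfin : {t | Θ t}.Finite) {t : Tree h} (ht : Θ t) : IsAclDefinable L {x | Ψ t x} := by
  obtain ⟨a, b, rfl⟩ := exists_eq_meet h t
  obtain ⟨θ, hθ⟩ := hΘ
  obtain ⟨ψ, hψ⟩ := hΨ
  obtain ⟨ε, hε⟩ := Dfn.eq (ι := Fin 2 ⊕ Fin 2) (h := h) (Sum.inl 0) (Sum.inl 1) (Sum.inr 0)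
    (Sum.inr 1)
  let g : (Fin 2 → M) → Tree h := fun q => meet h (q 0) (q 1)
  have hfib : ∀ q, fiber ψ q = {x | Ψ (g q) x} := fun q => Set.ext fun x => hψ _
  refine ⟨2, Setoid.comap g ⊥, ![a, b], ψ, ⟨ε, fun q r => (hε (Sum.elim q r)).symm⟩,
    ⟨θ, (hθ _).2 ht, ?_⟩, fun q r hqr => ?_, (hfib ![a, b]).symm⟩
  · let G : Quotient (Setoid.comap g ⊥) → Tree h := Quotient.lift g fun _ _ H => H
    refine (hfin.preimage (f := G) (Function.Injective.injOn ?_)).subset ?_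
    · rintro ⟨q⟩ ⟨r⟩ H
      exact Quotient.sound (s := Setoid.comap g ⊥) H
    · rintro _ ⟨q, hq, rfl⟩
      exact (hθ q).1 hq
  · rw [hfib, hfib, show g q = g r from hqr]

end Dfn

/-! ## Nodes at which a set is cut -/

section Mixed

variable {M : Type w} {C : M → M → M → Prop} {h : IsCRelation C} {A F : Set M}

/-- The thick cone at `t` meets both `A` and its complement. -/
def Mixed (A : Set M) (t : Tree h) : Prop :=
  (∃ x, t ≤ leaf h x ∧ x ∈ A) ∧ ∃ x, t ≤ leaf h x ∧ ¬ x ∈ A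

/-- A maximal mixed node. -/
def IsMaxMixed (A : Set M) (t : Tree h) : Prop :=
  Mixed A t ∧ ∀ s, t < s → ¬ Mixed A s

/-- A node that is not mixed and is the limit of the nodes below, all of which are mixed. -/
def IsLimitMixed (A : Set M) (b : Tree h) : Prop :=
  ¬ Mixed A b ∧ (∀ s, s < b → Mixed A s) ∧ (∃ s, s < b) ∧ ∀ s, s < b → ∃ s', s < s' ∧ s' < b

/-- The interval `[s, b[` is dense and the elements that branch off from `b` in it are in `A`. -/
def Tail (A : Set M) (b s : Tree h) : Prop :=
  s < b ∧ (∀ x, s ≤ leaf h x → ¬ b ≤ leaf h x → x ∈ A) ∧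
    ∀ u v, s ≤ u → u < v → v < b → ∃ z, u < z ∧ z < v

/-- The union of the pruned cones below `b` given by the tail intervals. -/
def tailSet (A : Set M) (b : Tree h) : Set M :=
  {x | ¬ b ≤ leaf h x ∧ ∃ s z, Tail A b s ∧ s < z ∧ z ≤ b ∧ z ≤ leaf h x}

theorem Mixed.mono {s t : Tree h} (hst : s ≤ t) (ht : Mixed A t) : Mixed A s :=
  ⟨ht.1.imp fun _ H => ⟨hst.trans H.1, H.2⟩, ht.2.imp fun _ H => ⟨hst.trans H.1, H.2⟩⟩

theorem mixed_of_mem {t : Tree h} {x y : M} (hx : t ≤ leaf h x) (hy : t ≤ leaf h y) (hxA : x ∈ A)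
    (hyA : y ∉ A) : Mixed A t := ⟨⟨x, hx, hxA⟩, ⟨y, hy, hyA⟩⟩

/-- If no `f ∈ F` lies above `t`, each `f` branches off at one and the same node from all elements
above `t`. They then have the same type over `F`, and `A` cannot separate them. -/
theorem Mixed.exists_le (hA : ∀ x y, SameQF C F x y → (x ∈ A ↔ y ∈ A)) {t : Tree h}
    (ht : Mixed A t) : ∃ f ∈ F, t ≤ leaf h f := by
  by_contra! hcon
  obtain ⟨⟨x, hx, hxA⟩, ⟨y, hy, hyA⟩⟩ := ht
  exact hyA ((hA x y (sameQF_of_meet_eq h fun f hf =>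
    meet_eq_meet_of_not_le hx hy (hcon f hf))).1 hxA)

/-- Otherwise every element of `F` leaves the branch strictly below `b`. A node `w < b` above all
these departures is mixed, yet no element of `F` lies above it. -/
theorem IsLimitMixed.exists_le (hF : F.Finite) (hA : ∀ x y, SameQF C F x y → (x ∈ A ↔ y ∈ A))
    {b : Tree h} (hb : IsLimitMixed A b) : ∃ f ∈ F, b ≤ leaf h f := by
  by_contra! hcon
  obtain ⟨β, hβ⟩ := exists_le_leaf b
  obtain ⟨w, hw, H⟩ := exists_lt_of_finite (Z := {s | s < b})
    (fun s hs t ht => le_total_of_le hs.le ht.le) hb.2.2.1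
    (fun s hs => (hb.2.2.2 s hs).imp fun _ H => ⟨H.2, H.1⟩) (hF.image fun f => meet h f β)
  obtain ⟨f, hf, hwf⟩ := (hb.2.1 w hw).exists_le hA
  have hlt : meet h f β < b := lt_of_not_le_leaf hβ (meet_le_right h f β)
    fun H => hcon f hf (H.trans (meet_le_left h f β))
  exact (H _ ⟨f, hf, rfl⟩ ⟨_, hlt, le_rfl⟩).not_ge
    ((le_meet_iff h).2 ⟨hwf, hw.le.trans hβ⟩)

theorem finite_isMaxMixed (hF : F.Finite) (hA : ∀ x y, SameQF C F x y → (x ∈ A ↔ y ∈ A)) :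
    {t : Tree h | IsMaxMixed A t}.Finite :=
  finite_of_subsingleton_below hF (fun _ ht => ht.1.exists_le hA) fun _ _ hs ht hst =>
    hst.eq_of_not_lt fun hlt => hs.2 _ hlt ht.1

theorem finite_isLimitMixed (hF : F.Finite) (hA : ∀ x y, SameQF C F x y → (x ∈ A ↔ y ∈ A)) :
    {t : Tree h | IsLimitMixed A t}.Finite :=
  finite_of_subsingleton_below hF (fun _ ht => ht.exists_le hF hA) fun _ _ hs ht hst =>
    hst.eq_of_not_lt fun hlt => hs.1 (ht.2.1 _ hlt)

theorem not_mixed_leaf (x : M) : ¬ Mixed A (leaf h x) := by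
  rintro ⟨⟨y, hy, hyA⟩, ⟨z, hz, hzA⟩⟩
  rw [← leaf_injective hy] at hyA
  rw [← leaf_injective hz] at hzA
  exact hzA hyA

/-- Mixed nodes lie on the finitely many branches of `F`. On a suitable one they have no greatest
element, and the sought limit is among the finitely many nodes g ∧ f with `g ∈ F`. -/
theorem exists_isLimitMixed (hF : F.Finite) (hA : ∀ x y, SameQF C F x y → (x ∈ A ↔ y ∈ A))
    (hmix : ∃ t : Tree h, Mixed A t) (hmax : ¬ ∃ t : Tree h, IsMaxMixed A t) :
    ∃ b : Tree h, IsLimitMixed A b := by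
  let B : M → Set (Tree h) := fun f => {t | Mixed A t ∧ t ≤ leaf h f}
  -- Maximality for inclusion prevents a greatest element t of `B f`: a mixed node above t would lie
  -- on the branch of some f', with `B f` strictly contained in `B f'`.
  obtain ⟨f, ⟨hf, hBf⟩, hfmax⟩ : ∃ f, MaximalFor (fun f => f ∈ F ∧ (B f).Nonempty) B f := by
    refine Set.Finite.exists_maximalFor B {f | f ∈ F ∧ (B f).Nonempty}
      (hF.subset fun _ H => H.1) ?_
    obtain ⟨t, ht⟩ := hmix
    obtain ⟨f, hf, hle⟩ := ht.exists_le hA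
    exact ⟨f, hf, t, ht, hle⟩
  have hchain : ∀ a ∈ B f, ∀ b ∈ B f, a ≤ b ∨ b ≤ a := fun a ha b hb =>
    le_total_of_le_leaf ha.2 hb.2
  have hnomax : ∀ t ∈ B f, ∃ t' ∈ B f, t < t' := by
    intro t ht
    by_contra! hcon
    obtain ⟨s, hts, hs⟩ : ∃ s, t < s ∧ Mixed A s := by
      by_contra! H
      exact hmax ⟨t, ht.1, H⟩
    obtain ⟨f', hf', hle⟩ := hs.exists_le hA
    have hsub : B f ⊆ B f' := by
      intro r hr
      refine ⟨hr.1, ?_⟩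
      rcases hchain r hr t ht with H | H
      · exact H.trans (hts.le.trans hle)
      · rw [← H.eq_of_not_lt (hcon r hr)]
        exact hts.le.trans hle
    exact hcon s (hfmax ⟨hf', s, hs, hle⟩ hsub ⟨hs, hle⟩) hts
  obtain ⟨b, ⟨⟨g, hg, hgb⟩, hb⟩, hbmin⟩ : ∃ b, Minimal
      (· ∈ {t : Tree h | t ∈ (fun g => meet h g f) '' F ∧ ¬ Mixed A t}) b := by
    refine Set.Finite.exists_minimal ((hF.image _).subset fun _ H => H.1)
      ⟨leaf h f, ⟨f, hf, rfl⟩, not_mixed_leaf f⟩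
  have hbf : b ≤ leaf h f := hgb ▸ meet_le_right h g f
  have hlt : ∀ s ∈ B f, s < b := fun s hs =>
    lt_of_not_le_leaf hbf hs.2 fun H => hb (hs.1.mono H)
  have hmixed : ∀ s, s < b → Mixed A s := by
    intro s hsb
    by_contra hs
    have hsf : s ≤ leaf h f := hsb.le.trans hbf
    -- No element of `F` leaves the branch of `f` in [s₁, b[. Hence elements leaving it between `s₁`
    -- and `s` have the type of `γ`, which leaves at `s`, and mixedness of `s₁` would pass up to
    -- `s`.
    obtain ⟨s₁, hs₁, H⟩ := exists_lt_of_finite hchain hBf hnomax (hF.image fun g => meet h g f)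
    have hs₁s : s₁ < s := lt_of_not_le_leaf hsf hs₁.2 fun H => hs (hs₁.1.mono H)
    have hno : ∀ g ∈ F, s₁ ≤ meet h g f → ¬ meet h g f < b := by
      intro g hg h1 h2
      by_cases hm : Mixed A (meet h g f)
      · exact (H _ ⟨g, hg, rfl⟩ ⟨_, ⟨hm, meet_le_right h g f⟩, le_rfl⟩).not_ge h1
      · exact h2.not_ge (hbmin ⟨⟨g, hg, rfl⟩, hm⟩ h2.le)
    obtain ⟨γ, hγ⟩ := exists_meet_eq hsf
    have key : ∀ x, s₁ ≤ leaf h x → ∃ x', s ≤ leaf h x' ∧ (x ∈ A ↔ x' ∈ A) := by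
      intro x hx
      by_cases hsx : s ≤ leaf h x
      · exact ⟨x, hsx, Iff.rfl⟩
      · refine ⟨γ, hγ ▸ meet_le_left h γ f, hA _ _ (sameQF_of_interval h (β := f) ?_ ?_)⟩
        · rw [hγ]
          exact (lt_of_not_le_leaf hsf (meet_le_right h x f)
            fun H => hsx (H.trans (meet_le_left h x f))).le
        · intro g hg h1 h2
          rw [hγ] at h2
          exact hno g hg (((le_meet_iff h).2 ⟨hx, hs₁.2⟩).trans h1) (h2.trans_lt hsb)
    obtain ⟨⟨x, hx, hxA⟩, ⟨y, hy, hyA⟩⟩ := hs₁.1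
    obtain ⟨x', hx', ex⟩ := key x hx
    obtain ⟨y', hy', ey⟩ := key y hy
    exact hs (mixed_of_mem hx' hy' (ex.1 hxA) fun H => hyA (ey.2 H))
  refine ⟨b, hb, hmixed, hBf.imp hlt, fun s hs => ?_⟩
  obtain ⟨s', hs', hlt'⟩ := hnomax s ⟨hmixed s hs, hs.le.trans hbf⟩
  exact ⟨s', hlt', hlt s' hs'⟩

/-- The part of `A` above a maximal mixed node is a finite union of cones or an almost thick
cone. -/
theorem IsMaxMixed.form (hF : F.Finite) (hA : ∀ x y, SameQF C F x y → (x ∈ A ↔ y ∈ A))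
    {t : Tree h} (ht : IsMaxMixed A t) :
    IsFiniteUnionOfCones h {x | t ≤ leaf h x ∧ x ∈ A} ∨
      IsAlmostThickCone h {x | t ≤ leaf h x ∧ x ∈ A} := by
  have same : ∀ {z x y}, t < z → z ≤ leaf h x → z ≤ leaf h y → x ∈ A → y ∈ A :=
    fun {z x y} hz hx hy hxA => by_contra fun hyA => ht.2 z hz (mixed_of_mem hx hy hxA hyA)
  -- Is there an element of `A` above `t` whose cone at `t` avoids `F`? If so, all such cones are
  -- inside `A`, which misses only cones of elements of `F`. If not, `A` consists, above `t`, of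
  -- cones of elements of `F`.
  by_cases hgen : ∃ x₀, t ≤ leaf h x₀ ∧ x₀ ∈ A ∧ ∀ f ∈ F, ¬ t < meet h f x₀
  · right
    obtain ⟨x₀, hx₀, hx₀A, hx₀F⟩ := hgen
    refine ⟨t, {y | ∃ f ∈ F, f ∉ A ∧ t < leaf h f ∧ leaf h f = y}, ?_, ?_, ⟨x₀, hx₀, hx₀A⟩, ?_⟩
    · refine (hF.image (leaf h)).subset ?_
      rintro _ ⟨f, hf, -, -, rfl⟩
      exact ⟨f, hf, rfl⟩
    · rintro _ ⟨f, hf, -, hlt, rfl⟩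
      exact hlt
    · ext x
      simp only [Set.mem_ofPred_eq, Set.mem_sdiff, Set.mem_iUnion, thickCone, cone,
        WithBot.coe_lt_coe]
      refine and_congr_right fun hx => ⟨?_, fun H => ?_⟩
      · rintro hxA ⟨_, ⟨f, hf, hfA, -, rfl⟩, z, hz, hzf, hzx⟩
        exact hfA (same hz hzx hzf hxA)
      · by_cases hex : ∃ f ∈ F, t < meet h f x
        · obtain ⟨f, hf, hlt⟩ := hex
          by_cases hfA : f ∈ A
          · exact same hlt (meet_le_left h f x) (meet_le_right h f x) hfA
          · exact absurd ⟨_, ⟨f, hf, hfA, hlt.trans_le (meet_le_left h f x), rfl⟩, _, hlt,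
              meet_le_left h f x, meet_le_right h f x⟩ H
        · refine (hA x x₀ (sameQF_of_meet_eq h fun f hf => ?_)).2 hx₀A
          by_cases htf : t ≤ leaf h f
          · rw [← ((le_meet_iff h).2 ⟨htf, hx⟩).eq_of_not_lt fun hlt => hex ⟨f, hf, hlt⟩,
              ← ((le_meet_iff h).2 ⟨htf, hx₀⟩).eq_of_not_lt (hx₀F f hf)]
          · exact meet_eq_meet_of_not_le hx hx₀ htf
  · left
    push Not at hgen
    refine ⟨t, {y | ∃ f ∈ F, f ∈ A ∧ t < leaf h f ∧ leaf h f = y},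
      fun H => absurd H WithBot.coe_ne_bot, ?_, ?_, ?_, ?_⟩
    · refine (hF.image (leaf h)).subset ?_
      rintro _ ⟨f, hf, -, -, rfl⟩
      exact ⟨f, hf, rfl⟩
    · obtain ⟨x, hx, hxA⟩ := ht.1.1
      obtain ⟨f, hf, hlt⟩ := hgen x hx hxA
      exact ⟨_, f, hf, same hlt (meet_le_right h f x) (meet_le_left h f x) hxA,
        hlt.trans_le (meet_le_left h f x), rfl⟩
    · rintro _ ⟨f, hf, -, hlt, rfl⟩
      exact WithBot.coe_lt_coe.2 hlt
    · ext x
      simp only [Set.mem_ofPred_eq, Set.mem_iUnion, cone, WithBot.coe_lt_coe]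
      constructor
      · rintro ⟨hx, hxA⟩
        obtain ⟨f, hf, hlt⟩ := hgen x hx hxA
        exact ⟨_, ⟨f, hf, same hlt (meet_le_right h f x) (meet_le_left h f x) hxA,
          hlt.trans_le (meet_le_left h f x), rfl⟩, _, hlt, meet_le_left h f x, meet_le_right h f x⟩
      · rintro ⟨_, ⟨f, hf, hfA, -, rfl⟩, z, hz, hzf, hzx⟩
        exact ⟨hz.le.trans hzx, same hz hzf hzx hfA⟩

theorem Tail.mono {b s s' : Tree h} (hs : Tail A b s) (hss' : s ≤ s') (hs' : s' < b) :
    Tail A b s' :=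
  ⟨hs', fun x hx => hs.2.1 x (hss'.trans hx), fun u v hu => hs.2.2 u v (hss'.trans hu)⟩

theorem tailSet_subset {b : Tree h} : tailSet A b ⊆ A := by
  rintro x ⟨hx, s, z, hs, hsz, -, hzx⟩
  exact hs.2.1 x (hsz.le.trans hzx) hx

theorem tailSet_nonempty {b s : Tree h} (hb : IsLimitMixed A b) (hs : Tail A b s) :
    (tailSet A b).Nonempty := by
  obtain ⟨β, hβ⟩ := exists_le_leaf b
  obtain ⟨s', hss', hs'⟩ := hb.2.2.2 s hs.1
  obtain ⟨y, hy⟩ := exists_meet_eq (hs'.le.trans hβ)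
  refine ⟨y, fun H => hs'.not_ge ?_, s, s', hs, hss', hs'.le, hy ▸ meet_le_left h y β⟩
  rw [← hy]
  exact (le_meet_iff h).2 ⟨H, hβ⟩

/-- By `H`, the point `a` is the lower end of the interval of tail nodes. Its nodes are tails,
whence density and, below any of them, no least node; there is no greatest one because `b` is a
limit. -/
theorem isDensePrunedCone_of_forall {b : Tree h} (hb : IsLimitMixed A b)
    (hne : ∃ s, Tail A b s) {a : WithBot (Tree h)} (ha : InTreeStar h a)
    (H : ∀ z, z < b → (a < (z : WithBot (Tree h)) ↔ ∃ s, Tail A b s ∧ s < z)) :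
    IsDensePrunedCone h (tailSet A b) := by
  have tail : ∀ z, z < b → a < (z : WithBot (Tree h)) → Tail A b z := fun z hz haz => by
    obtain ⟨s, hs, hsz⟩ := (H z hz).1 haz
    exact hs.mono hsz.le hz
  obtain ⟨s₀, hs₀⟩ := hne
  obtain ⟨s₁, hs₀₁, hs₁⟩ := hb.2.2.2 s₀ hs₀.1
  have has₁ : a < (s₁ : WithBot (Tree h)) := (H s₁ hs₁).2 ⟨s₀, hs₀, hs₀₁⟩
  have lift : ∀ x : Set.Ioo a (b : WithBot (Tree h)), ∃ z : Tree h, (z : WithBot (Tree h)) = x ∧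
      z < b ∧ a < (z : WithBot (Tree h)) := by
    rintro ⟨x, hx⟩
    obtain ⟨z, rfl⟩ := WithBot.ne_bot_iff_exists.1 (ne_bot_of_gt hx.1)
    exact ⟨z, rfl, WithBot.coe_lt_coe.1 hx.2, hx.1⟩
  refine ⟨a, b, ha, has₁.trans (WithBot.coe_lt_coe.2 hs₁), ⟨s₁, has₁, WithBot.coe_lt_coe.2 hs₁⟩,
    ⟨fun x y hxy => ?_⟩, ⟨fun x => ?_⟩, ⟨fun x => ?_⟩, ?_⟩
  · obtain ⟨z, hz, hzb, haz⟩ := lift x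
    obtain ⟨z', hz', hzb', -⟩ := lift y
    rw [← Subtype.coe_lt_coe, ← hz, ← hz', WithBot.coe_lt_coe] at hxy
    obtain ⟨r, h1, h2⟩ := (tail z hzb haz).2.2 z z' le_rfl hxy hzb'
    refine ⟨⟨r, haz.trans (WithBot.coe_lt_coe.2 h1), WithBot.coe_lt_coe.2 (h2.trans hzb')⟩, ?_, ?_⟩
    · rw [← Subtype.coe_lt_coe, ← hz]; exact WithBot.coe_lt_coe.2 h1
    · rw [← Subtype.coe_lt_coe, ← hz']; exact WithBot.coe_lt_coe.2 h2
  · obtain ⟨z, hz, hzb, haz⟩ := lift x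
    obtain ⟨s, hs, hsz⟩ := (H z hzb).1 haz
    obtain ⟨r, h1, h2⟩ := hs.2.2 s z le_rfl hsz hzb
    refine ⟨⟨r, (H r (h2.trans hzb)).2 ⟨s, hs, h1⟩, WithBot.coe_lt_coe.2 (h2.trans hzb)⟩, ?_⟩
    rw [← Subtype.coe_lt_coe, ← hz]; exact WithBot.coe_lt_coe.2 h2
  · obtain ⟨z, hz, hzb, haz⟩ := lift x
    obtain ⟨r, h1, h2⟩ := hb.2.2.2 z hzb
    refine ⟨⟨r, haz.trans (WithBot.coe_lt_coe.2 h1), WithBot.coe_lt_coe.2 h2⟩, ?_⟩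
    rw [← Subtype.coe_lt_coe, ← hz]; exact WithBot.coe_lt_coe.2 h1
  · ext x
    simp only [tailSet, prunedCone, cone, thickCone, Set.mem_sdiff, Set.mem_ofPred_eq]
    rw [and_comm]
    refine and_congr_left fun hx => ⟨?_, ?_⟩
    · rintro ⟨s, z, hs, hsz, hzb, hzx⟩
      have hlt : z < b := lt_of_le_of_ne hzb (by rintro rfl; exact hx hzx)
      exact ⟨z, (H z hlt).2 ⟨s, hs, hsz⟩, hzb, hzx⟩
    · rintro ⟨z, haz, hzb, hzx⟩
      have hlt : z < b := lt_of_le_of_ne hzb (by rintro rfl; exact hx hzx)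
      obtain ⟨s, hs, hsz⟩ := (H z hlt).1 haz
      exact ⟨s, z, hs, hsz, hzb, hzx⟩

/-- The node `t` is the `k`-th immediate successor of `s`. -/
def NthSucc : ℕ → Tree h → Tree h → Prop
  | 0, s, t => s = t
  | k + 1, s, t => ∃ r, NthSucc k s r ∧ r < t ∧ ∀ z, r < z → ¬ z < t

theorem NthSucc.unique {k : ℕ} {s t t' : Tree h} {x : M} (ht : NthSucc k s t)
    (ht' : NthSucc k s t') (hx : t ≤ leaf h x) (hx' : t' ≤ leaf h x) : t = t' := by
  induction k generalizing t t' with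
  | zero => exact ht.symm.trans ht'
  | succ k ih =>
    obtain ⟨r, hr, hrt, H⟩ := ht
    obtain ⟨r', hr', hrt', H'⟩ := ht'
    obtain rfl := ih hr hr' (hrt.le.trans hx) (hrt'.le.trans hx')
    rcases le_total_of_le_leaf hx hx' with h1 | h1
    · exact h1.eq_of_not_lt (H' t hrt)
    · exact (h1.eq_of_not_lt (H t' hrt')).symm

end Mixed

/-! ### Finding an `acl(∅)`-definable subset of the prescribed form -/

section Form

variable {L : FirstOrder.Language.{u, v}} {M : Type w} [L.Structure M] {c : L.Relations 3}
  {h : IsCRelation (crel c M)} {A : Set M}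

theorem Dfn.mixed {ι : Type*} (hA : (∅ : Set M).Definable₁ L A) (i j : ι) :
    Dfn L fun v : ι → M => Mixed A (meet h (v i) (v j)) :=
  (Dfn.ex ((Dfn.leLeaf _ _ _).and (Dfn.mem hA _))).and
    (Dfn.ex ((Dfn.leLeaf _ _ _).and (Dfn.mem hA _).not))

theorem Dfn.isMaxMixed {ι : Type*} (hA : (∅ : Set M).Definable₁ L A) (i j : ι) :
    Dfn L fun v : ι → M => IsMaxMixed A (meet h (v i) (v j)) :=
  (Dfn.mixed hA i j).and (Dfn.allTree ((Dfn.lt _ _ _ _).imp (Dfn.mixed hA _ _).not))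

theorem Dfn.isLimitMixed {ι : Type*} (hA : (∅ : Set M).Definable₁ L A) (i j : ι) :
    Dfn L fun v : ι → M => IsLimitMixed A (meet h (v i) (v j)) :=
  (Dfn.mixed hA i j).not.and
    ((Dfn.allTree ((Dfn.lt _ _ _ _).imp (Dfn.mixed hA _ _))).and
      ((Dfn.exTree (Dfn.lt _ _ _ _)).and (Dfn.allTree ((Dfn.lt _ _ _ _).imp
        (Dfn.exTree ((Dfn.lt _ _ _ _).and (Dfn.lt _ _ _ _)))))))

theorem Dfn.tail {ι : Type*} (hA : (∅ : Set M).Definable₁ L A) (i j k l : ι) :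
    Dfn L fun v : ι → M => Tail A (meet h (v i) (v j)) (meet h (v k) (v l)) :=
  (Dfn.lt _ _ _ _).and
    ((Dfn.all ((Dfn.leLeaf _ _ _).imp ((Dfn.leLeaf _ _ _).not.imp (Dfn.mem hA _)))).and
      (Dfn.allTree (Dfn.allTree ((Dfn.le _ _ _ _).imp ((Dfn.lt _ _ _ _).imp ((Dfn.lt _ _ _ _).imp
        (Dfn.exTree ((Dfn.lt _ _ _ _).and (Dfn.lt _ _ _ _)))))))))

theorem Dfn.mem_tailSet {ι : Type*} (hA : (∅ : Set M).Definable₁ L A) (i j k : ι) :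
    Dfn L fun v : ι → M => v k ∈ tailSet A (meet h (v i) (v j)) :=
  (Dfn.leLeaf _ _ _).not.and (Dfn.exTree (Dfn.exTree ((Dfn.tail hA _ _ _ _).and
    ((Dfn.lt _ _ _ _).and ((Dfn.le _ _ _ _).and (Dfn.leLeaf _ _ _))))))

theorem Dfn.nthSucc (n : ℕ) {ι : Type*} (i j k l : ι) :
    Dfn L fun v : ι → M => NthSucc n (meet h (v i) (v j)) (meet h (v k) (v l)) := by
  induction n generalizing ι with
  | zero => exact Dfn.eq i j k l
  | succ n ih =>
    exact Dfn.exTree ((ih _ _ _ _).and ((Dfn.lt _ _ _ _).and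
      (Dfn.allTree ((Dfn.lt _ _ _ _).imp (Dfn.lt _ _ _ _).not))))

/-- Below a node there is no infinite discrete chain. -/
theorem HasFiniteTypes.exists_no_succ (hft : HasFiniteTypes L M) {s₀ b : Tree h} (hs₀ : s₀ < b) :
    ∃ u, s₀ ≤ u ∧ u < b ∧ ∀ v, u < v → v < b → ∃ z, u < z ∧ z < v := by
  by_contra! hcon
  choose nxt h1 h2 h3 using hcon
  -- Iterated immediate successors of `s₀`. Being the n-th successor is definable, so the triples
  -- formed with these nodes would have pairwise different types.
  let u : ℕ → {u : Tree h // s₀ ≤ u ∧ u < b} := fun n => Nat.rec ⟨s₀, le_rfl, hs₀⟩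
    (fun _ r => ⟨nxt r.1 r.2.1 r.2.2, r.2.1.trans (h1 r.1 r.2.1 r.2.2).le, h2 r.1 r.2.1 r.2.2⟩) n
  have hu : ∀ n, (u (n + 1)).1 = nxt (u n).1 (u n).2.1 (u n).2.2 := fun n => rfl
  have hmono : StrictMono fun n => (u n).1 := strictMono_nat_of_lt_succ fun n => by
    rw [hu]; exact h1 _ _ _
  have hsucc : ∀ n, NthSucc n (u 0).1 (u n).1 := by
    intro n
    induction n with
    | zero => rfl
    | succ n ih =>
      refine ⟨_, ih, hmono n.lt_succ_self, fun z hz hz' => ?_⟩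
      rw [hu] at hz'
      exact h3 _ _ _ z hz hz'
  obtain ⟨β, hβ⟩ := exists_le_leaf b
  choose x hx using fun n => exists_meet_eq ((u n).2.2.le.trans hβ)
  have := hft 3
  obtain ⟨n, m, hnm, H⟩ := Finite.exists_ne_map_eq_of_infinite fun n : ℕ =>
    (Quotient.mk (typeSetoid L M (Fin 3)) ![β, x 0, x n])
  have hsame : Same L ![β, x 0, x n] ![β, x 0, x m] := Quotient.exact H
  have key := (Dfn.nthSucc (h := h) n (1 : Fin 3) 0 2 0).same hsame
  simp only [Matrix.cons_val_zero, Matrix.cons_val_one, Matrix.cons_val, hx] at key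
  exact hnm (hmono.injective ((hsucc n).unique (key.1 (hsucc n)) ((u n).2.2.le.trans hβ)
    ((u m).2.2.le.trans hβ)))

/-- Close enough to `b`, no parameter leaves the branch of `β`, so all elements that do leave it
there have the same type. What holds for one of them, membership in `A` or absence of an immediate
successor of its node, holds for all. -/
theorem exists_tail (hM : IsCMinimal c M) (hft : HasFiniteTypes L M)
    {F : Set M} (hF : F.Finite) (hFA : ∀ x y, SameQF (crel c M) F x y → (x ∈ A ↔ y ∈ A))
    {b : Tree h} (hb : IsLimitMixed A b) (hbA : ∀ x, b ≤ leaf h x → x ∉ A) :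
    ∃ s, Tail A b s := by
  obtain ⟨β, β', rfl⟩ := exists_eq_meet h b
  set b := meet h β β' with hbdef
  have hβ : b ≤ leaf h β := meet_le_left h β β'
  -- `G` decides whether the node x ∧ β has no immediate successor below `b`.
  obtain ⟨G, hG, hGR⟩ := hM.exists_finite (ι := Fin 2)
    (R := fun v => ∀ t : Tree h, meet h (v (Sum.inr ())) (v (Sum.inl 0)) < t →
      t < meet h (v (Sum.inl 0)) (v (Sum.inl 1)) →
      ∃ z, meet h (v (Sum.inr ())) (v (Sum.inl 0)) < z ∧ z < t)
    (Dfn.allTree ((Dfn.lt _ _ _ _).imp ((Dfn.lt _ _ _ _).imp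
      (Dfn.exTree ((Dfn.lt _ _ _ _).and (Dfn.lt _ _ _ _)))))) ![β, β']
  simp only [Sum.elim_inl, Sum.elim_inr, Matrix.cons_val_zero, Matrix.cons_val_one] at hGR
  rw [← hbdef] at hGR
  obtain ⟨s₀, hs₀, H⟩ := exists_lt_of_finite (Z := {s | s < b})
    (fun s hs t ht => le_total_of_le hs.le ht.le) hb.2.2.1
    (fun s hs => (hb.2.2.2 s hs).imp fun _ H => ⟨H.2, H.1⟩)
    ((hF.union hG).image fun f => meet h f β)
  have hno : ∀ f ∈ F ∪ G, s₀ ≤ meet h f β → ¬ meet h f β < b := fun f hf h1 h2 =>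
    (H _ ⟨f, hf, rfl⟩ ⟨_, h2, le_rfl⟩).not_ge h1
  have hs₀β : s₀ ≤ leaf h β := hs₀.le.trans hβ
  have hlt : ∀ x, ¬ b ≤ leaf h x → meet h x β < b := fun x hx =>
    lt_of_not_le_leaf hβ (meet_le_right h x β) fun H => hx (H.trans (meet_le_left h x β))
  have same : ∀ x y, s₀ ≤ meet h x β → meet h x β < b → s₀ ≤ meet h y β → meet h y β < b →
      SameQF (crel c M) (F ∪ G) x y ∨ SameQF (crel c M) (F ∪ G) y x := by
    intro x y hx hxb hy hyb
    rcases le_total_of_le_leaf (meet_le_right h x β) (meet_le_right h y β) with h1 | h1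
    · exact Or.inl (sameQF_of_interval h h1 fun f hf h2 h3 =>
        hno f hf (hx.trans h2) (h3.trans_lt hyb))
    · exact Or.inr (sameQF_of_interval h h1 fun f hf h2 h3 =>
        hno f hf (hy.trans h2) (h3.trans_lt hxb))
  refine ⟨s₀, hs₀, fun x hx hxb => ?_, ?_⟩
  · obtain ⟨a, ha, haA⟩ := (hb.2.1 s₀ hs₀).1
    rcases same a x ((le_meet_iff h).2 ⟨ha, hs₀β⟩) (hlt a fun H => hbA a H haA)
      ((le_meet_iff h).2 ⟨hx, hs₀β⟩) (hlt x hxb) with h1 | h1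
    · exact (hFA _ _ (h1.mono Set.subset_union_left)).1 haA
    · exact (hFA _ _ (h1.mono Set.subset_union_left)).2 haA
  · obtain ⟨u, hs₀u, hub, hu⟩ := hft.exists_no_succ hs₀
    intro u' t hu' hlt' htb
    obtain ⟨x, rfl⟩ := exists_meet_eq (hub.le.trans hβ)
    obtain ⟨y, rfl⟩ := exists_meet_eq ((hlt'.trans htb).le.trans hβ)
    rcases same x y hs₀u hub hu' (hlt'.trans htb) with h1 | h1
    · exact (hGR _ _ (h1.mono Set.subset_union_right)).1 hu t hlt' htb
    · exact (hGR _ _ (h1.mono Set.subset_union_right)).2 hu t hlt' htb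

/-- The tail nodes form a final segment below `b`, and the axis needs a lower end: the least tail
node, -∞, or the greatest node below `b` that is not a tail node. C-minimality forbids any other
cut. -/
theorem isDensePrunedCone_tailSet (hM : IsCMinimal c M) (hA : (∅ : Set M).Definable₁ L A)
    {b : Tree h} (hb : IsLimitMixed A b) (hne : ∃ s, Tail A b s) :
    IsDensePrunedCone h (tailSet A b) := by
  by_cases hmin : ∃ a, Tail A b a ∧ ∀ s, Tail A b s → a ≤ s
  · obtain ⟨a, ha, hamin⟩ := hmin
    refine isDensePrunedCone_of_forall hb hne (a := a) (fun H => absurd H WithBot.coe_ne_bot)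
      fun z hz => ?_
    rw [WithBot.coe_lt_coe]
    exact ⟨fun haz => ⟨a, ha, haz⟩, fun ⟨s, hs, hsz⟩ => (hamin s hs).trans_lt hsz⟩
  have hmin' : ∀ s, Tail A b s → ∃ s', Tail A b s' ∧ s' < s := by
    intro s hs
    by_contra! hcon
    exact hmin ⟨s, hs, fun s' hs' => by
      by_contra hle
      exact hcon s' hs' (lt_of_not_le hs.1.le hs'.1.le hle)⟩
  by_cases hall : ∀ s, s < b → Tail A b s
  · refine isDensePrunedCone_of_forall hb hne (a := ⊥) ?_ fun z hz => ?_
    -- A root would be a least tail node, so -∞ is a legitimate basis.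
    · rintro - ⟨r, hr⟩
      obtain ⟨s, hs⟩ := hb.2.2.1
      exact hmin ⟨r, hall r ((hr s).trans_lt hs), fun s _ => hr s⟩
    · exact iff_of_true (WithBot.bot_lt_coe z) (hmin' z (hall z hz))
  push Not at hall
  obtain ⟨a, ⟨hab, haT⟩, hamax⟩ : ∃ a, (a < b ∧ ¬ Tail A b a) ∧
      ∀ s, s < b → ¬ Tail A b s → s ≤ a := by
    by_contra! hcon
    obtain ⟨β, β', hbdef⟩ := exists_eq_meet h b
    have hβ : b ≤ leaf h β := hbdef ▸ meet_le_left h β β'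
    obtain ⟨G, hG, hGR⟩ := hM.exists_finite (ι := Fin 2)
      (R := fun v => Tail A (meet h (v (Sum.inl 0)) (v (Sum.inl 1)))
        (meet h (v (Sum.inr ())) (v (Sum.inl 0))))
      (Dfn.tail hA _ _ _ _) ![β, β']
    simp only [Sum.elim_inl, Sum.elim_inr, Matrix.cons_val_zero, Matrix.cons_val_one] at hGR
    rw [← hbdef] at hGR
    obtain ⟨w₁, ⟨hw₁, hw₁T⟩, H₁⟩ := exists_lt_of_finite (Z := {s | s < b ∧ ¬ Tail A b s})
      (fun s hs t ht => le_total_of_le hs.1.le ht.1.le) hall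
      (fun s hs => by
        obtain ⟨s', h1, h2, h3⟩ := hcon s hs
        exact ⟨s', ⟨h1, h2⟩, lt_of_not_le h1.le hs.1.le h3⟩) (hG.image fun f => meet h f β)
    -- Both sides of the cut lack an end point, so `w₁` and `w₂` enclose no branching node of `G`.
    -- Elements leaving at `w₁` and at `w₂` then have the same type over `G`, although only `w₂` is
    -- a tail node.
    obtain ⟨w₂, hw₂T, H₂⟩ := exists_gt_of_finite (Z := {s | Tail A b s})
      (fun s hs t ht => le_total_of_le hs.1.le ht.1.le) hne hmin' (hG.image fun f => meet h f β)
    have hw₂ : w₂ < b := hw₂T.1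
    obtain ⟨x, hx⟩ := exists_meet_eq (hw₁.le.trans hβ)
    obtain ⟨y, hy⟩ := exists_meet_eq (hw₂.le.trans hβ)
    have hle : w₁ ≤ w₂ := (le_total_of_le hw₁.le hw₂.le).resolve_right
      fun H => hw₁T (hw₂T.mono H hw₁)
    have hsame : SameQF (crel c M) G x y := by
      refine sameQF_of_interval h (β := β) (by rwa [hx, hy]) fun f hf h1 h2 => ?_
      rw [hx] at h1
      rw [hy] at h2
      by_cases hT : Tail A b (meet h f β)
      · exact (H₂ _ ⟨f, hf, rfl⟩ ⟨_, hT, le_rfl⟩).not_ge h2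
      · exact (H₁ _ ⟨f, hf, rfl⟩ ⟨_, ⟨h2.trans_lt hw₂, hT⟩, le_rfl⟩).not_ge h1
    have := hGR x y hsame
    rw [hx, hy] at this
    exact hw₁T (this.2 hw₂T)
  refine isDensePrunedCone_of_forall hb hne (a := a) (fun H => absurd H WithBot.coe_ne_bot)
    fun z hz => ?_
  rw [WithBot.coe_lt_coe]
  constructor
  · intro haz
    exact hmin' z (by_contra fun hzT => haz.not_ge (hamax z hz hzT))
  · rintro ⟨s, hs, hsz⟩
    exact (lt_of_not_le hs.1.le hab.le fun H => haT (hs.mono H hab)).trans hsz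

/-- A nonempty definable set contains a nonempty `acl(∅)`-definable set which is a finite union of
cones, an almost thick cone or a dense pruned cone. -/
theorem exists_form (hM : IsCMinimal c M) (hft : HasFiniteTypes L M)
    (hA : (∅ : Set M).Definable₁ L A) (hne : A.Nonempty) :
    ∃ X ⊆ A, X.Nonempty ∧ IsAclDefinable L X ∧
      (IsFiniteUnionOfCones h X ∨ IsAlmostThickCone h X ∨ IsDensePrunedCone h X) := by
  obtain ⟨F, hF, hFA⟩ := hM.exists_finite (ι := Empty) (Dfn.mem hA (Sum.inr ())) Empty.elim
  simp only [Sum.elim_inr] at hFA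
  obtain ⟨α, hα⟩ := hne
  by_cases huniv : ∀ x, x ∈ A
  · refine ⟨Set.univ, fun x _ => huniv x, ⟨α, trivial⟩, ?_, ?_⟩
    · refine ⟨0, ⊤, Fin.elim0, ⊤, ⟨⊤, fun q r => ?_⟩, ⟨⊤, by simp, Set.toFinite _⟩, fun q r _ => ?_,
        ?_⟩
      · exact iff_of_true trivial (by simp)
      · rw [Subsingleton.elim q r]
      · ext x
        exact iff_of_true trivial (by simp [fiber])
    · by_cases hr : ∃ r : Tree h, ∀ t, r ≤ t
      · obtain ⟨r, hr⟩ := hr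
        refine Or.inr (Or.inl ⟨r, ∅, Set.finite_empty, by simp, ⟨α, trivial⟩, ?_⟩)
        ext x
        simp [thickCone, hr]
      · refine Or.inl ⟨⊥, {leaf h α}, fun _ => hr, Set.finite_singleton _, ⟨_, rfl⟩,
          fun y _ => WithBot.bot_lt_coe y, ?_⟩
        ext x
        simp only [Set.mem_univ, Set.mem_singleton_iff, Set.iUnion_iUnion_eq_left, true_iff]
        exact ⟨meet h α x, WithBot.bot_lt_coe _, meet_le_left h α x, meet_le_right h α x⟩
  by_cases hmax : ∃ t : Tree h, IsMaxMixed A t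
  · obtain ⟨t, ht⟩ := hmax
    refine ⟨{x | t ≤ leaf h x ∧ x ∈ A}, fun x hx => hx.2, ht.1.1, ?_, ?_⟩
    · exact isAclDefinable_of_finite (Θ := IsMaxMixed A) (Ψ := fun t x => t ≤ leaf h x ∧ x ∈ A)
        (Dfn.isMaxMixed hA _ _) ((Dfn.leLeaf _ _ _).and (Dfn.mem hA _))
        (finite_isMaxMixed hF hFA) ht
    · rcases ht.form hF hFA with H | H
      · exact Or.inl H
      · exact Or.inr (Or.inl H)
  push Not at huniv
  obtain ⟨β, hβ⟩ := huniv
  obtain ⟨b, hb⟩ := exists_isLimitMixed hF hFA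
    ⟨meet h α β, mixed_of_mem (meet_le_left h α β) (meet_le_right h α β) hα hβ⟩ hmax
  -- Since `b` is not mixed, its thick cone is inside `A` or disjoint from `A`.
  by_cases hbA : ∀ x, b ≤ leaf h x → x ∈ A
  · refine ⟨{x | b ≤ leaf h x}, hbA, exists_le_leaf b, ?_, Or.inr (Or.inl ⟨b, ∅, Set.finite_empty,
      by simp, exists_le_leaf b, by simp [thickCone]⟩)⟩
    exact isAclDefinable_of_finite (Θ := IsLimitMixed A) (Ψ := fun t x => t ≤ leaf h x)
      (Dfn.isLimitMixed hA _ _) (Dfn.leLeaf _ _ _) (finite_isLimitMixed hF hFA) hb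
  · push Not at hbA
    obtain ⟨y, hy, hyA⟩ := hbA
    obtain ⟨s, hs⟩ := exists_tail hM hft hF hFA hb fun x hx hxA =>
      hb.1 (mixed_of_mem hx hy hxA hyA)
    exact ⟨tailSet A b, tailSet_subset, tailSet_nonempty hb hs,
      isAclDefinable_of_finite (Θ := IsLimitMixed A) (Ψ := fun t x => x ∈ tailSet A t)
        (Dfn.isLimitMixed hA _ _) (Dfn.mem_tailSet hA _ _ _) (finite_isLimitMixed hF hFA) hb,
      Or.inr (Or.inr (isDensePrunedCone_tailSet hM hA hb ⟨s, hs⟩))⟩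

end Form

/-! ## Cuts in the branches of an indiscernible set -/

section Cuts

variable {M : Type w} {C : M → M → M → Prop} {h : IsCRelation C} {A F : Set M}

/-- The nodes at which an element of `A` branches off from `α`. -/
def branchNodes (A : Set M) (α : M) : Set (Tree h) :=
  {s | ∃ β, β ∈ A ∧ s = meet h β α}

/-- The node `t` of the branch of `α` determines a cut of `branchNodes A α` in which neither of
the two parts has an end point. -/
def IsGap (A : Set M) (α : M) (t : Tree h) : Prop :=
  t ≤ leaf h α ∧ ¬ t ∈ branchNodes A α ∧ (∃ s, s ∈ branchNodes A α ∧ s < t) ∧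
    (∀ s, s ∈ branchNodes A α → s < t → ∃ s', s' ∈ branchNodes A α ∧ s < s' ∧ s' < t) ∧
    ∀ s, s ∈ branchNodes A α → t < s → ∃ s', s' ∈ branchNodes A α ∧ t < s' ∧ s' < s

theorem branchNodes_le {α : M} {s : Tree h} (hs : s ∈ branchNodes A α) : s ≤ leaf h α := by
  obtain ⟨β, -, rfl⟩ := hs
  exact meet_le_right h β α

/-- Strictly below α ∧ γ the branches of `α` and `γ` coincide, and an element leaving one there
leaves the other at the same node. -/
theorem mem_branchNodes_of_lt {α γ : M} {s : Tree h} (hs : s ∈ branchNodes A α)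
    (hlt : s < meet h α γ) : s ∈ branchNodes A γ := by
  obtain ⟨β, hβ, rfl⟩ := hs
  exact ⟨β, hβ, (meet_eq_meet_of_lt hlt).symm⟩

/-- Gaps are represented by finitely many nodes. -/
theorem IsGap.exists_node {G : Set M} {α : M}
    (hG : ∀ x y, SameQF C G x y → (meet h x α ∈ branchNodes A α ↔ meet h y α ∈ branchNodes A α))
    (hGf : G.Finite) {t : Tree h} (ht : IsGap A α t) :
    ∃ f ∈ G, IsGap A α (meet h f α) ∧ ∀ s ∈ branchNodes A α, s < meet h f α → s < t := by
  obtain ⟨htα, htQ, hne, hlow, hup⟩ := ht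
  have tot : ∀ {a b : Tree h}, a ≤ leaf h α → b ≤ leaf h α → ¬ a ≤ b → b < a := fun ha hb =>
    lt_of_not_le_leaf ha hb
  -- From `w` on, a node of `G` below `t` exceeds all branch nodes below `t`. One exists in [w, t],
  -- as otherwise `w` and `t` would be alike over `G`; it determines the same cut as `t`.
  obtain ⟨w, ⟨hwQ, hwt⟩, H⟩ := exists_lt_of_finite (Z := {s | s ∈ branchNodes A α ∧ s < t})
    (fun a ha b hb => le_total_of_le ha.2.le hb.2.le) hne
    (fun s hs => (hlow s hs.1 hs.2).imp fun _ H => ⟨⟨H.1, H.2.2⟩, H.2.1⟩)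
    (hGf.image fun f => meet h f α)
  obtain ⟨f, hf, hwf, hft⟩ : ∃ f ∈ G, w ≤ meet h f α ∧ meet h f α ≤ t := by
    by_contra! hcon
    obtain ⟨x, rfl⟩ := exists_meet_eq (branchNodes_le hwQ)
    obtain ⟨y, rfl⟩ := exists_meet_eq htα
    exact htQ ((hG x y (sameQF_of_interval h hwt.le hcon)).1 hwQ)
  have hnot : ∀ s ∈ branchNodes A α, s < t → s < meet h f α := fun s hs hst =>
    tot (meet_le_right h f α) (branchNodes_le hs) fun hle =>
      (H _ ⟨f, hf, rfl⟩ ⟨s, ⟨hs, hst⟩, hle⟩).not_ge hwf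
  have hQ : ¬ meet h f α ∈ branchNodes A α := fun hQ =>
    (hnot _ hQ (hft.lt_of_ne (by rintro heq; exact htQ (heq ▸ hQ)))).false
  have hlt : ∀ s ∈ branchNodes A α, s < meet h f α → s < t := fun s _ hs => hs.trans_le hft
  refine ⟨f, hf, ⟨meet_le_right h f α, hQ, ?_, ?_, ?_⟩, hlt⟩
  · exact hne.imp fun s hs => ⟨hs.1, hnot s hs.1 hs.2⟩
  · intro s hs hsf
    obtain ⟨s', hs', h1, h2⟩ := hlow s hs (hlt s hs hsf)
    exact ⟨s', hs', h1, hnot s' hs' h2⟩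
  · intro s hs hsf
    have hts : t < s := by
      refine lt_of_le_of_ne ?_ (by rintro rfl; exact htQ hs)
      by_contra hle
      exact (hnot s hs (tot htα (branchNodes_le hs) hle)).not_gt hsf
    obtain ⟨s', hs', h1, h2⟩ := hup s hs hts
    exact ⟨s', hs', hft.trans_lt h1, h2⟩

variable {L : FirstOrder.Language.{u, v}} {N : Type w} [L.Structure N] {c : L.Relations 3}
  {k : IsCRelation (crel c N)} {B : Set N}

theorem Dfn.mem_branchNodes {ι : Type*} (hB : (∅ : Set N).Definable₁ L B) (i j l : ι) :
    Dfn L fun v : ι → N => meet k (v i) (v j) ∈ branchNodes B (v l) :=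
  Dfn.ex ((Dfn.mem hB _).and (Dfn.eq _ _ _ _))

theorem Dfn.isGap {ι : Type*} (hB : (∅ : Set N).Definable₁ L B) (i j l : ι) :
    Dfn L fun v : ι → N => IsGap B (v l) (meet k (v i) (v j)) :=
  (Dfn.leLeaf _ _ _).and ((Dfn.mem_branchNodes hB _ _ _).not.and
    ((Dfn.exTree ((Dfn.mem_branchNodes hB _ _ _).and (Dfn.lt _ _ _ _))).and
      ((Dfn.allTree ((Dfn.mem_branchNodes hB _ _ _).imp ((Dfn.lt _ _ _ _).imp
        (Dfn.exTree ((Dfn.mem_branchNodes hB _ _ _).and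
          ((Dfn.lt _ _ _ _).and (Dfn.lt _ _ _ _))))))).and
      (Dfn.allTree ((Dfn.mem_branchNodes hB _ _ _).imp ((Dfn.lt _ _ _ _).imp
        (Dfn.exTree ((Dfn.mem_branchNodes hB _ _ _).and
          ((Dfn.lt _ _ _ _).and (Dfn.lt _ _ _ _))))))))))

/-- In an indiscernible definable set there are no gaps. -/
theorem not_isGap (hN : IsCMinimal c N) (hB : (∅ : Set N).Definable₁ L B)
    (hind : IsIndiscernibleSet L B) {α : N} (hα : α ∈ B) (t : Tree k) : ¬ IsGap B α t := by
  intro ht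
  obtain ⟨F, hF, hFB⟩ := hN.exists_finite (ι := Empty) (Dfn.mem hB (Sum.inr ())) Empty.elim
  simp only [Sum.elim_inr] at hFB
  obtain ⟨G, hG, hGB⟩ := hN.exists_finite (ι := Unit)
    (Dfn.mem_branchNodes (k := k) hB (Sum.inr ()) (Sum.inl ()) (Sum.inl ())) (fun _ => α)
  simp only [Sum.elim_inr, Sum.elim_inl] at hGB
  -- Gaps are represented in a finite set, so there is a lowest one.
  obtain ⟨r, ⟨-, hr⟩, hrmin⟩ : ∃ r, Minimal
      (· ∈ {r : Tree k | r ∈ (fun f => meet k f α) '' G ∧ IsGap B α r}) r := by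
    obtain ⟨f, hf, hfgap, -⟩ := ht.exists_node hGB hG
    exact Set.Finite.exists_minimal ((hG.image _).subset fun _ H => H.1) ⟨_, ⟨f, hf, rfl⟩, hfgap⟩
  have hlowest : ∀ t, IsGap B α t → ∀ s ∈ branchNodes B α, s < r → s < t := by
    intro t ht s hs hsr
    obtain ⟨f, hf, hfgap, hft⟩ := ht.exists_node hGB hG
    refine hft s hs (hsr.trans_le ?_)
    rcases le_total_of_le_leaf hr.1 hfgap.1 with H | H
    · exact H
    · exact hrmin ⟨⟨f, hf, rfl⟩, hfgap⟩ H
  obtain ⟨w, ⟨hwQ, hwr⟩, H⟩ := exists_lt_of_finite (Z := {s | s ∈ branchNodes B α ∧ s < r})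
    (fun a ha b hb => le_total_of_le ha.2.le hb.2.le) hr.2.2.1
    (fun s hs => (hr.2.2.2.1 s hs.1 hs.2).imp fun _ H => ⟨⟨H.1, H.2.2⟩, H.2.1⟩)
    (hF.image fun f => meet k f α)
  obtain ⟨γ, hγ, hw⟩ := id hwQ
  -- An `f` that shares with `γ` more than `w` would leave the branch of `α` exactly at `w`, which
  -- was chosen past such departures.
  have hγF : ∀ f ∈ F, ¬ w < meet k f γ := by
    intro f hf hlt
    rw [hw, meet_comm k γ α, meet_comm k f γ] at hlt
    have : meet k f α = w := by
      rw [meet_comm k f α, meet_eq_meet_of_lt hlt, meet_comm k α γ, hw]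
    exact (H _ ⟨f, hf, rfl⟩ ⟨w, ⟨hwQ, hwr⟩, this.le⟩).ne this
  have hdef : Dfn L fun v : Unit → N => ∃ t : Tree k, IsGap B (v ()) t :=
    Dfn.exTree (Dfn.isGap hB _ _ _)
  obtain ⟨t', ht'⟩ : ∃ t : Tree k, IsGap B γ t :=
    (hdef.same (p := fun _ => α) (q := fun _ => γ) (hind α hα γ hγ)).1 ⟨t, ht⟩
  have hwγ : w ∈ branchNodes B γ := ⟨α, hα, by rw [hw, meet_comm]⟩
  have hwα : w ≤ leaf k α := branchNodes_le hwQ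
  -- No element of `B` leaves the branch of `γ` at `t'`, so `t'` is mixed and some `f ∈ F` lies
  -- above it. Elements of `F` share with `γ` nothing beyond `w`.
  have ht'w : t' < w := by
    obtain ⟨δ, hδ⟩ := exists_meet_eq ht'.1
    have hδB : δ ∉ B := fun H => ht'.2.1 ⟨δ, H, hδ.symm⟩
    obtain ⟨f, hf, hft'⟩ := (mixed_of_mem ht'.1 (hδ ▸ meet_le_left k δ γ) hγ hδB).exists_le hFB
    have h1 : t' ≤ meet k f γ := (le_meet_iff k).2 ⟨hft', ht'.1⟩
    have h2 : meet k f γ ≤ w := by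
      by_contra hle
      exact hγF f hf (lt_of_not_le_leaf (meet_le_right k f γ) (branchNodes_le hwγ) hle)
    exact (h1.trans h2).lt_of_ne (by rintro rfl; exact ht'.2.1 hwγ)
  -- Below `w` the elements `α` and `γ` have the same branch nodes, so `t'` is a gap of `α` as well.
  -- It lies below the branch node `w < r`, against the choice of `r`.
  have e1 : ∀ s ∈ branchNodes B γ, s < w → s ∈ branchNodes B α := fun s hs hsw =>
    mem_branchNodes_of_lt hs (hw ▸ hsw)
  have e2 : ∀ s ∈ branchNodes B α, s < w → s ∈ branchNodes B γ := fun s hs hsw =>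
    mem_branchNodes_of_lt hs (by rwa [meet_comm, ← hw])
  refine (hlowest t' ⟨ht'w.le.trans hwα, fun hQ => ht'.2.1 (e2 _ hQ ht'w), ?_, ?_, ?_⟩ w hwQ
    hwr).not_gt ht'w
  · obtain ⟨s, hs, hst⟩ := ht'.2.2.1
    exact ⟨s, e1 s hs (hst.trans ht'w), hst⟩
  · intro s hs hst
    obtain ⟨s', hs', h1, h2⟩ := ht'.2.2.2.1 s (e2 s hs (hst.trans ht'w)) hst
    exact ⟨s', e1 s' hs' (h2.trans ht'w), h1, h2⟩
  · intro s hs hts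
    by_cases hsw : w ≤ s
    · obtain ⟨s', hs', h1, h2⟩ := ht'.2.2.2.2 w hwγ ht'w
      exact ⟨s', e1 s' hs' h2, h1, h2.trans_le hsw⟩
    · have hsw' := lt_of_not_le_leaf hwα (branchNodes_le hs) hsw
      obtain ⟨s', hs', h1, h2⟩ := ht'.2.2.2.2 s (e2 s hs hsw') hts
      exact ⟨s', e1 s' hs' (h2.trans hsw'), h1, h2⟩

end Cuts

/-! ## Traces on an indiscernible set -/

section Trace

theorem SameQF.left {N : Type w} {C : N → N → N → Prop} {F : Set N} {x y : N}
    (hxy : SameQF C F x y) {f g : N} (hf : f ∈ F) (hg : g ∈ F) : C x f g ↔ C y f g :=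
  (hxy (Sum.inr ()) (Sum.inl f) (Sum.inl g) (by simp) (by simpa using hf) (by simpa using hg)).2

theorem SameQF.middle {N : Type w} {C : N → N → N → Prop} {F : Set N} {x y : N}
    (hxy : SameQF C F x y) {f g : N} (hf : f ∈ F) (hg : g ∈ F) : C f x g ↔ C f y g :=
  (hxy (Sum.inl f) (Sum.inr ()) (Sum.inl g) (by simpa using hf) (by simp) (by simpa using hg)).2

variable {M : Type w} {C : M → M → M → Prop} {h : IsCRelation C} {A : Set M}

/-- The trace on `A` of a thick cone is determined by finitely many elements of `A`. -/
theorem exists_trace_thickCone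
    (hgap : ∀ α ∈ A, ∀ t : Tree h, ¬ IsGap A α t) (t : Tree h) :
    ∃ F : Set A, F.Finite ∧ ∀ x y : A, SameQF (fun a b d : A => C a b d) F x y →
      (t ≤ leaf h x → t ≤ leaf h y) := by
  by_cases hne : ∃ α ∈ A, t ≤ leaf h α
  swap
  · exact ⟨∅, Set.finite_empty, fun x y _ hx => absurd ⟨x, x.2, hx⟩ hne⟩
  obtain ⟨α, hα, htα⟩ := hne
  have thick : ∀ β ∈ A, (∀ x ∈ A, t ≤ leaf h x ↔ meet h β α ≤ leaf h x) →
      ∃ F : Set A, F.Finite ∧ ∀ x y : A, SameQF (fun a b d : A => C a b d) F x y →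
      (t ≤ leaf h x → t ≤ leaf h y) := by
    intro β hβ H
    refine ⟨{⟨α, hα⟩, ⟨β, hβ⟩}, Set.toFinite _, fun x y hxy => ?_⟩
    rw [H x x.2, H y y.2, meet_le_leaf_iff, meet_le_leaf_iff]
    exact (not_congr (hxy.left (f := ⟨β, hβ⟩) (g := ⟨α, hα⟩) (by simp) (by simp))).1
  have opn : ∀ β ∈ A, (∀ x ∈ A, t ≤ leaf h x ↔ ¬ meet h x α ≤ leaf h β) →
      ∃ F : Set A, F.Finite ∧ ∀ x y : A, SameQF (fun a b d : A => C a b d) F x y →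
      (t ≤ leaf h x → t ≤ leaf h y) := by
    intro β hβ H
    refine ⟨{⟨α, hα⟩, ⟨β, hβ⟩}, Set.toFinite _, fun x y hxy => ?_⟩
    rw [H x x.2, H y y.2, ← rel_iff, ← rel_iff]
    exact (hxy.middle (f := ⟨β, hβ⟩) (g := ⟨α, hα⟩) (by simp) (by simp)).1
  by_cases htQ : t ∈ branchNodes A α
  · obtain ⟨β, hβ, rfl⟩ := htQ
    exact thick β hβ fun x _ => Iff.rfl
  have le_iff : ∀ x, t ≤ leaf h x ↔ t ≤ meet h x α := fun x => by
    rw [le_meet_iff]; exact ⟨fun H => ⟨H, htα⟩, And.left⟩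
  have lt_of : ∀ x ∈ A, t ≤ leaf h x → t < meet h x α := fun x hx htx =>
    ((le_iff x).1 htx).lt_of_ne (by rintro rfl; exact htQ ⟨x, hx, rfl⟩)
  have hnot := hgap α hα t
  -- Each remaining failure defines the trace over `A`. With no branch node below `t` it is all of
  -- `A`; with a greatest one it is the cone of `α` there; with a least one above `t` it is the
  -- thick cone there.
  simp only [IsGap, not_and_or] at hnot
  rcases hnot with H | H | H | H | H
  · exact absurd htα H
  · exact absurd htQ H
  · refine ⟨∅, Set.finite_empty, fun x y _ _ => ?_⟩
    rw [le_iff]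
    by_contra hcon
    exact H ⟨_, ⟨y, y.2, rfl⟩, lt_of_not_le_leaf htα (meet_le_right h y α) hcon⟩
  · push Not at H
    obtain ⟨s, ⟨β, hβ, rfl⟩, hst, hmax⟩ := H
    refine opn β hβ fun x hx => ?_
    have e : meet h x α ≤ leaf h β ↔ meet h x α ≤ meet h β α := by
      rw [le_meet_iff]; exact ⟨fun H => ⟨H, meet_le_right h x α⟩, And.left⟩
    rw [e, le_iff]
    constructor
    · exact fun H => (hst.trans_le H).not_ge
    · intro H
      by_contra hcon
      exact hmax _ ⟨x, hx, rfl⟩ (lt_of_not_le_leaf (meet_le_right h x α) (meet_le_right h β α) H)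
        (lt_of_not_le_leaf htα (meet_le_right h x α) hcon)
  · push Not at H
    obtain ⟨s, ⟨β, hβ, rfl⟩, hts, hmin⟩ := H
    refine thick β hβ fun x hx => ⟨fun H => ?_, fun H => hts.le.trans H⟩
    by_contra hcon
    exact hmin _ ⟨x, hx, rfl⟩ (lt_of x hx H) (lt_of_not_le_leaf (meet_le_right h β α)
      (meet_le_right h x α) fun H => hcon (H.trans (meet_le_left h x α)))

/-- The trace on `A` of a cone is determined by finitely many elements of `A`. -/
theorem exists_trace_cone
    (hgap : ∀ α ∈ A, ∀ t : Tree h, ¬ IsGap A α t) (f g : M) :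
    ∃ F : Set A, F.Finite ∧ ∀ x y : A, SameQF (fun a b d : A => C a b d) F x y →
      (C f x g → C f y g) := by
  by_cases hne : ∃ α ∈ A, C f α g
  swap
  · exact ⟨∅, Set.finite_empty, fun x y _ hx => absurd ⟨x, x.2, hx⟩ hne⟩
  obtain ⟨α, hα, hfα⟩ := hne
  set t := meet h f g with ht
  have rel : ∀ x, C f x g ↔ t < meet h x g := by
    intro x
    rw [rel_iff h]
    constructor
    · exact fun H => lt_of_not_le_leaf (meet_le_right h x g) (meet_le_right h f g)
        fun H' => H (H'.trans (meet_le_left h f g))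
    · exact fun H H' => H.not_ge ((le_meet_iff h).2 ⟨H', meet_le_right h x g⟩)
  have hαt : t < meet h α g := (rel α).1 hfα
  have rel' : ∀ x, C f x g ↔ t < meet h x α := by
    intro x
    rw [rel]
    constructor
    · intro H
      rcases le_total_of_le_leaf (meet_le_right h x g) (meet_le_right h α g) with h1 | h1
      · exact H.trans_le ((le_meet_iff h).2 ⟨meet_le_left h x g, h1.trans (meet_le_left h α g)⟩)
      · exact hαt.trans_le ((le_meet_iff h).2 ⟨h1.trans (meet_le_left h x g), meet_le_left h α g⟩)
    · intro H
      rcases le_total_of_le_leaf (meet_le_right h x α) (meet_le_left h α g) with h1 | h1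
      · exact H.trans_le ((le_meet_iff h).2 ⟨meet_le_left h x α, h1.trans (meet_le_right h α g)⟩)
      · exact hαt.trans_le ((le_meet_iff h).2 ⟨h1.trans (meet_le_left h x α), meet_le_right h α g⟩)
  have htα : t ≤ leaf h α := hαt.le.trans (meet_le_left h α g)
  -- If some `β ∈ A` leaves `α` at the basis, it can replace `f`. If none does, the cone and the
  -- thick cone at `t` have the same trace.
  by_cases htQ : t ∈ branchNodes A α
  · obtain ⟨β, hβ, hβt⟩ := htQ
    refine ⟨{⟨α, hα⟩, ⟨β, hβ⟩}, Set.toFinite _, fun x y hxy => ?_⟩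
    have e : ∀ x, C f x g ↔ C β x α := by
      intro x
      rw [rel', rel_iff h, hβt]
      constructor
      · exact fun H H' => H.not_ge ((le_meet_iff h).2 ⟨H', meet_le_right h x α⟩)
      · exact fun H => lt_of_not_le_leaf (meet_le_right h x α) (meet_le_right h β α)
          fun H' => H (H'.trans (meet_le_left h β α))
    rw [e, e]
    exact (hxy.middle (f := ⟨β, hβ⟩) (g := ⟨α, hα⟩) (by simp) (by simp)).1
  · obtain ⟨F, hF, H⟩ := exists_trace_thickCone hgap t
    refine ⟨F, hF, fun x y hxy => ?_⟩
    have e : ∀ x ∈ A, C f x g ↔ t ≤ leaf h x := by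
      intro x hx
      rw [rel']
      constructor
      · exact fun H => H.le.trans (meet_le_left h x α)
      · exact fun H => ((le_meet_iff h).2 ⟨H, htα⟩).lt_of_ne fun heq => htQ ⟨x, hx, heq⟩
    rw [e x x.2, e y y.2]
    exact H x y hxy

theorem SameQF.symm {N : Type w} {C : N → N → N → Prop} {F : Set N} {x y : N}
    (hxy : SameQF C F x y) : SameQF C F y x := fun i j k hi hj hk =>
  ⟨(hxy i j k hi hj hk).1.symm, (hxy i j k hi hj hk).2.symm⟩

/-- By `IsCRelation.sameQF`, the type over `F` is determined by membership in finitely many thick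
cones and cones, one of each for every pair from `F`; their traces need finitely many parameters
from `A`. -/
theorem exists_trace (hgap : ∀ α ∈ A, ∀ t : Tree h, ¬ IsGap A α t) {F : Set M} (hF : F.Finite) :
    ∃ G : Set A, G.Finite ∧ ∀ x y : A, SameQF (fun a b d : A => C a b d) G x y →
      SameQF C F x y := by
  choose G₁ hG₁ H₁ using exists_trace_thickCone hgap
  choose G₂ hG₂ H₂ using exists_trace_cone hgap
  refine ⟨⋃ f ∈ F, ⋃ g ∈ F, (G₁ (meet h f g) ∪ G₂ f g), hF.biUnion fun f _ => hF.biUnion fun g _ =>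
    (hG₁ _).union (hG₂ f g), fun x y hxy => ?_⟩
  have sub : ∀ f ∈ F, ∀ g ∈ F, G₁ (meet h f g) ∪ G₂ f g ⊆
      ⋃ f ∈ F, ⋃ g ∈ F, (G₁ (meet h f g) ∪ G₂ f g) := fun f hf g hg a ha =>
    Set.mem_biUnion hf (Set.mem_biUnion hg ha)
  refine h.sameQF (fun f hf g hg => ?_) (fun f hf g hg => ?_)
  · have := hxy.mono (Set.subset_union_left.trans (sub f hf g hg))
    rw [rel_iff h, rel_iff h, not_iff_not]
    exact ⟨H₁ _ x y this, H₁ _ y x this.symm⟩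
  · have := hxy.mono (Set.subset_union_right.trans (sub f hf g hg))
    exact ⟨H₂ f g x y this, H₂ f g y x this.symm⟩

end Trace

/-! ## Induced structures -/

section Induced

variable {L : FirstOrder.Language.{u, v}} {M : Type w} [L.Structure M] {A : Set M}

theorem induced_term_eq_var {α : Type*} (t : (inducedLanguage L A).Term α) :
    ∃ m, t = Language.Term.var m := by
  cases t with
  | var m => exact ⟨m, rfl⟩
  | func f _ => exact Empty.elim f

/-- The relation symbols name sets definable in `M`, and quantifiers are relativized to the
definable set `A`. -/
theorem exists_formula_of_induced_bounded (hA : (∅ : Set M).Definable₁ L A) {α : Type*} {n : ℕ}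
    (φ : (inducedLanguage L A).BoundedFormula α n) :
    ∃ ψ : L.Formula (α ⊕ Fin n), ∀ (v : α → A) (xs : Fin n → A),
      φ.Realize v xs ↔ ψ.Realize (fun i => ((Sum.elim v xs i : A) : M)) := by
  induction φ with
  | falsum => exact ⟨⊥, fun v xs => by simp [Language.BoundedFormula.Realize]⟩
  | equal t₁ t₂ =>
    obtain ⟨i, rfl⟩ := induced_term_eq_var t₁
    obtain ⟨j, rfl⟩ := induced_term_eq_var t₂
    refine ⟨(Language.Term.var i).equal (Language.Term.var j), fun v xs => ?_⟩
    rw [Language.Formula.realize_equal]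
    simp [Language.BoundedFormula.Realize, Subtype.ext_iff]
  | @rel n l D ts =>
    choose m hm using fun i => induced_term_eq_var (ts i)
    obtain ⟨ψ, hψ⟩ := Set.empty_definable_iff.1 D.2
    refine ⟨ψ.relabel m, fun v xs => ?_⟩
    rw [Language.Formula.realize_relabel]
    have h1 : ψ.Realize ((fun i => ((Sum.elim v xs i : A) : M)) ∘ m) ↔
        ((fun i => ((Sum.elim v xs i : A) : M)) ∘ m) ∈
          (fun (x : Fin l → A) (i : Fin l) => (x i : M)) '' D.1 := by rw [hψ]; rfl
    rw [h1]
    have h2 : (Language.BoundedFormula.rel D ts).Realize v xs ↔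
        (fun i => Sum.elim v xs (m i)) ∈ D.1 := by
      have : (fun i => (ts i).realize (Sum.elim v xs)) = fun i => Sum.elim v xs (m i) := by
        funext i; rw [hm i]; rfl
      rw [← this]
      exact Iff.rfl
    rw [h2]
    constructor
    · exact fun H => ⟨_, H, rfl⟩
    · rintro ⟨x, hx, hxe⟩
      convert hx using 1
      funext i
      exact Subtype.ext (congrFun hxe i).symm
  | imp _ _ ih₁ ih₂ =>
    obtain ⟨ψ₁, h₁⟩ := ih₁
    obtain ⟨ψ₂, h₂⟩ := ih₂
    refine ⟨ψ₁.imp ψ₂, fun v xs => ?_⟩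
    rw [Language.BoundedFormula.realize_imp, Language.Formula.realize_imp, h₁, h₂]
  | @all n φ ih =>
    obtain ⟨ψ, hψ⟩ := ih
    obtain ⟨χ, hχ⟩ := Dfn.mem (L := L) hA ()
    let g : α ⊕ Fin (n + 1) → (α ⊕ Fin n) ⊕ Unit :=
      Sum.elim (Sum.inl ∘ Sum.inl) (Fin.lastCases (Sum.inr ()) (Sum.inl ∘ Sum.inr))
    refine ⟨((χ.relabel Sum.inr).imp (ψ.relabel g)).iAlls Unit, fun v xs => ?_⟩
    rw [Language.BoundedFormula.realize_all, Language.Formula.realize_iAlls]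
    have key : ∀ a : A, φ.Realize v (Fin.snoc xs a) ↔ (ψ.relabel g).Realize
        (fun i => Sum.elim (fun i => ((Sum.elim v xs i : A) : M)) (fun _ : Unit => (a : M)) i) := by
      intro a
      rw [hψ, Language.Formula.realize_relabel]
      refine iff_of_eq (congrArg _ (funext ?_))
      rintro (i | i)
      · rfl
      · cases i using Fin.lastCases <;> simp [g]
    constructor
    · intro H i
      rw [Language.Formula.realize_imp, Language.Formula.realize_relabel, hχ]
      exact fun hi => (key ⟨i (), hi⟩).1 (H _)
    · intro H a
      have := H fun _ => a
      rw [Language.Formula.realize_imp, Language.Formula.realize_relabel, hχ] at this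
      exact (key a).2 (this a.2)

/-- Every formula of the induced structure is equivalent to a formula of the ambient structure. -/
theorem exists_formula_of_induced (hA : (∅ : Set M).Definable₁ L A) {ι : Type*}
    (φ : (inducedLanguage L A).Formula ι) :
    ∃ ψ : L.Formula ι, ∀ v : ι → A, φ.Realize v ↔ ψ.Realize fun i => (v i : M) := by
  obtain ⟨ψ, hψ⟩ := exists_formula_of_induced_bounded hA φ
  refine ⟨ψ.relabel (Sum.elim id Fin.elim0), fun v => ?_⟩
  rw [Language.Formula.realize_relabel, Language.Formula.Realize, hψ]
  refine iff_of_eq (congrArg _ (funext ?_))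
  rintro (i | i)
  · rfl
  · exact i.elim0

theorem same_induced (hA : (∅ : Set M).Definable₁ L A) {ι : Type*} {p q : ι → A}
    (hpq : Same L (fun i => (p i : M)) fun i => (q i : M)) : Same (inducedLanguage L A) p q := by
  intro φ
  obtain ⟨ψ, hψ⟩ := exists_formula_of_induced hA φ
  rw [hψ, hψ]
  exact hpq ψ

theorem HasFiniteTypes.induced (hM : HasFiniteTypes L M) (hA : (∅ : Set M).Definable₁ L A) :
    HasFiniteTypes (inducedLanguage L A) A := by
  intro n
  have := hM n
  refine Finite.of_injective (β := Quotient (typeSetoid L M (Fin n)))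
    (fun d => Quotient.mk _ fun i => (d.out i : M)) fun d e hde => ?_
  have h1 : Same L (fun i => (d.out i : M)) fun i => (e.out i : M) := Quotient.exact hde
  rw [← Quotient.out_eq d, ← Quotient.out_eq e]
  exact Quotient.sound (s := typeSetoid (inducedLanguage L A) A (Fin n)) (same_induced hA h1)

end Induced

/-! ### C-minimality of the induced structure -/

section Minimal

variable {L : FirstOrder.Language.{u, v}} {c : L.Relations 3}

theorem Same.crel_iff {N₁ N₂ : Type w} [L.Structure N₁] [L.Structure N₂] {ι : Type*}
    {p : ι → N₁} {q : ι → N₂} (hpq : Same L p q) (i j k : ι) :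
    crel c N₁ (p i) (p j) (p k) ↔ crel c N₂ (q i) (q j) (q k) := by
  have key : ∀ (N : Type w) [L.Structure N] (r : ι → N), (c.formula ![Language.Term.var i,
      Language.Term.var j, Language.Term.var k]).Realize r ↔ crel c N (r i) (r j) (r k) := by
    intro N _ r
    rw [Language.Formula.realize_rel]
    change _ ↔ Language.Structure.RelMap c _
    apply iff_of_eq
    congr 1
    funext i
    fin_cases i <;> rfl
  rw [← key, ← key]
  exact hpq _

/-- If finitely many types are realized, it suffices to check `C`-minimality in the structure
itself. -/
theorem isCMinimal_of_hasFiniteTypes {N : Type w} [L.Structure N] (hN : HasFiniteTypes L N)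
    (h : IsCRelation (crel c N))
    (hmin : ∀ (κ : Type w) (φ : L.Formula (κ ⊕ Fin 1)) (p : κ → N), ∃ F : Set N, F.Finite ∧
      ∀ x y, SameQF (crel c N) F x y →
        (φ.Realize (Sum.elim p fun _ => x) ↔ φ.Realize (Sum.elim p fun _ => y))) :
    IsCMinimal c N := by
  refine ⟨h, fun N' _ e S hS => ?_⟩
  obtain ⟨P, -, hP⟩ := Set.definable_iff_finitely_definable.1 hS
  obtain ⟨φ, hφ⟩ := Set.definable_iff_exists_formula_sum.1 hP
  let q : ↥(P : Set N') → N' := Subtype.val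
  have hSφ : ∀ x, x ∈ S ↔ φ.Realize (Sum.elim q fun _ => x) := fun x =>
    Set.ext_iff.1 hφ fun _ => x
  -- The parameters `q` are copied into `N`, where a finite `F` controls the set; `F` is copied back
  -- as `b`. Any `x'`, `y'` to be compared over `b` are then copied into `N` and compared over `F`.
  obtain ⟨p, hpq⟩ := hN.exists_same e q
  obtain ⟨F, hF, hFφ⟩ := hmin _ φ p
  have := hF.to_subtype
  obtain ⟨b, hb⟩ := hN.extend hpq (Subtype.val : F → N)
  refine isQFDefinable_of_finite (F := Set.range b) (Set.finite_range b) fun x' y' hxy => ?_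
  obtain ⟨a, ha⟩ := hN.extend' hb ![x', y']
  have hsame : SameQF (crel c N) F (a 0) (a 1) := by
    refine h.sameQF (fun f hf g hg => ?_) (fun f hf g hg => ?_)
    · have h1 := ha.crel_iff (c := c) (Sum.inr 0) (Sum.inl (Sum.inr ⟨f, hf⟩))
        (Sum.inl (Sum.inr ⟨g, hg⟩))
      have h2 := ha.crel_iff (c := c) (Sum.inr 1) (Sum.inl (Sum.inr ⟨f, hf⟩))
        (Sum.inl (Sum.inr ⟨g, hg⟩))
      exact h1.trans ((hxy.left ⟨_, rfl⟩ ⟨_, rfl⟩).trans h2.symm)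
    · have h1 := ha.crel_iff (c := c) (Sum.inl (Sum.inr ⟨f, hf⟩)) (Sum.inr 0)
        (Sum.inl (Sum.inr ⟨g, hg⟩))
      have h2 := ha.crel_iff (c := c) (Sum.inl (Sum.inr ⟨f, hf⟩)) (Sum.inr 1)
        (Sum.inl (Sum.inr ⟨g, hg⟩))
      exact h1.trans ((hxy.middle ⟨_, rfl⟩ ⟨_, rfl⟩).trans h2.symm)
  have real : ∀ i : Fin 2, φ.Realize (Sum.elim p fun _ => a i) ↔
      φ.Realize (Sum.elim q fun _ => (![x', y'] : Fin 2 → N') i) := by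
    intro i
    have := ha.comp (Sum.elim (Sum.inl ∘ Sum.inl) (fun _ : Fin 1 => Sum.inr i)) φ
    convert this using 2
    · funext j; rcases j with j | j <;> rfl
    · funext j; rcases j with j | j <;> rfl
  rw [hSφ, hSφ]
  exact (real 0).symm.trans ((hFφ _ _ hsame).trans (real 1))

variable {M : Type w} [L.Structure M] {A : Set M}

/-- C-minimality of `M` gives parameters `F` in `M`; absence of gaps exchanges them for parameters
`G` in `A`. -/
theorem isCMinimal_induced (hM : IsCMinimal c M) (hft : HasFiniteTypes L M)
    (hA : (∅ : Set M).Definable₁ L A) (hind : IsIndiscernibleSet L A) :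
    IsCMinimal (inducedC c hA) A := by
  have h : IsCRelation (crel (inducedC c hA) A) :=
    ⟨fun x y z => hM.1.symm (x : M) y z, fun x y z => hM.1.asymm (x : M) y z,
      fun x y z t => hM.1.trans (x : M) y z t,
      fun x y hxy => hM.1.ne (x : M) y fun H => hxy (Subtype.ext H)⟩
  refine isCMinimal_of_hasFiniteTypes (hft.induced hA) h fun κ φ p => ?_
  obtain ⟨ψ, hψ⟩ := exists_formula_of_induced hA φ
  obtain ⟨F, hF, hFψ⟩ := hM.exists_finite (ι := κ)
    (R := fun v => ψ.Realize fun i => v (Sum.map id (fun _ => ()) i))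
    ⟨ψ.relabel (Sum.map id fun _ => ()), fun v => by
      rw [Language.Formula.realize_relabel]; rfl⟩ (fun i => (p i : M))
  obtain ⟨G, hG, hGF⟩ := exists_trace (h := hM.1)
    (fun α hα t => not_isGap hM hA hind hα t) hF
  refine ⟨G, hG, fun x y hxy => ?_⟩
  have := hFψ x y (hGF x y hxy)
  rw [hψ, hψ]
  convert this using 2
  · funext i; rcases i with i | i <;> rfl
  · funext i; rcases i with i | i <;> rfl

end Minimal

/-! ## The canonical partition -/

section Partition

variable {L : FirstOrder.Language.{u, v}} {M : Type w} [L.Structure M]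

/-- The relation on elements of having the same type over `∅`. -/
def elementSetoid (L : FirstOrder.Language.{u, v}) (M : Type w) [L.Structure M] : Setoid M :=
  Setoid.comap (fun (a : M) (_ : Unit) => a) (typeSetoid L M Unit)

theorem isIndiscernibleSet_class (a : M) :
    IsIndiscernibleSet L {x | elementSetoid L M x a} := fun _ hx _ hy =>
  Same.trans hx (Same.symm hy)

/-- An indiscernible set containing `a` is contained in the set of realizations of the type of `a`,
itself indiscernible. This forces uniqueness of the partition. -/
theorem eq_class_of_maximal {A : Set M} (hA : Maximal (IsIndiscernibleSet L) A) {a : M}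
    (ha : a ∈ A) : A = {x | elementSetoid L M x a} :=
  hA.eq_of_subset (isIndiscernibleSet_class a) fun _ hx => hA.1 _ hx a ha

/-- There are finitely many 1-types, and the formula isolating each one defines its set of
realizations. -/
theorem HasFiniteTypes.isCanonicalPartition (hft : HasFiniteTypes L M) :
    IsCanonicalPartition L (elementSetoid L M).classes := by
  refine ⟨Setoid.isPartition_classes _, ?_, ?_⟩
  · have := hft.finite Unit
    refine Set.Finite.subset (Set.finite_range fun d : Quotient (typeSetoid L M Unit) =>
      {x : M | elementSetoid L M x (d.out ())}) ?_
    rintro _ ⟨a, rfl⟩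
    refine ⟨Quotient.mk _ fun _ => a, ?_⟩
    have h1 : Same L (Quotient.mk (typeSetoid L M Unit) fun _ => a).out fun _ => a :=
      Quotient.mk_out (s := typeSetoid L M Unit) _
    ext x
    exact ⟨fun H => Same.trans H h1, fun H => Same.trans H h1.symm⟩
  · rintro _ ⟨a, rfl⟩
    refine ⟨?_, isIndiscernibleSet_class a, fun B hB hle b hb => ?_⟩
    · obtain ⟨θ, h1, h2⟩ := hft.isolate fun _ : Unit => a
      refine Set.empty_definable_iff.2 ⟨θ.relabel fun _ => 0, ?_⟩
      ext x
      have : Set.ofPred (θ.relabel fun _ => (0 : Fin 1)).Realize x ↔ θ.Realize fun _ => x 0 := by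
        change Language.Formula.Realize _ x ↔ _
        rw [Language.Formula.realize_relabel]; rfl
      refine Iff.trans ?_ this.symm
      exact ⟨fun H => ((H : Same L _ _) θ).2 h1, fun H => (h2 _ H).symm⟩
    · exact hB b hb a (hle ((elementSetoid L M).refl a))

theorem IsCanonicalPartition.eq_classes {P : Set (Set M)} (hP : IsCanonicalPartition L P) :
    P = (elementSetoid L M).classes := by
  ext A
  constructor
  · intro hA
    obtain ⟨a, ha⟩ := Set.nonempty_iff_ne_empty.2 fun H => hP.1.1 (H ▸ hA)
    exact ⟨a, eq_class_of_maximal (hP.2.2 A hA).2 ha⟩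
  · rintro ⟨a, rfl⟩
    obtain ⟨A, ⟨hA, ha⟩, -⟩ := hP.1.2 a
    rwa [← eq_class_of_maximal (hP.2.2 A hA).2 ha]

/-- A maximal indiscernible definable set is the orbit of each of its nonempty definable
subsets. -/
theorem eq_orbit (hft : HasFiniteTypes L M) {A X : Set M} (hA : (∅ : Set M).Definable₁ L A)
    (hind : IsIndiscernibleSet L A) (hXA : X ⊆ A) (hX : X.Nonempty)
    (hacl : IsAclDefinable L X) : A = orbit L X := by
  obtain ⟨n, -, p, φ, -, -, -, rfl⟩ := hacl
  ext y
  constructor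
  · intro hy
    obtain ⟨x, hx⟩ := hX
    -- As `x` and `y` have the same type, `(x, p)` extends to a matching `(y, q)`, and `y` lies in
    -- the conjugate of `X` over `q`.
    obtain ⟨q, hq⟩ := hft.extend (show Same L (fun _ : Unit => x) fun _ => y from
      hind x (hXA hx) y hy) p
    refine ⟨_, ⟨n, φ, p, q, hq.comp Sum.inr, rfl, rfl⟩, ?_⟩
    have := hq.comp Sum.swap φ
    rw [Sum.elim_swap, Sum.elim_swap] at this
    exact this.1 hx
  · rintro ⟨_, ⟨m, ψ, r, q, hrq, hX', rfl⟩, hy⟩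
    -- Conversely, an element of a conjugate has the type of some element of `X ⊆ A`, and `A` is
    -- definable without parameters.
    obtain ⟨x, hx⟩ := hft.extend (show Same L q r from Same.symm hrq) (fun _ : Unit => y)
    have h1 : x () ∈ fiber ψ r := (hx ψ).1 hy
    rw [← hX'] at h1
    exact ((Dfn.mem hA (Sum.inr ())).same hx).2 (hXA h1)

theorem eq_iUnion_image [Countable M] (hft : HasFiniteTypes L M) {A X : Set M}
    (hA : (∅ : Set M).Definable₁ L A) (hind : IsIndiscernibleSet L A) (hXA : X ⊆ A)
    (hX : X.Nonempty) : A = ⋃ σ : M ≃[L] M, σ '' X := by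
  ext y
  rw [Set.mem_iUnion]
  constructor
  · intro hy
    obtain ⟨x, hx⟩ := hX
    obtain ⟨σ, hσ⟩ := hft.exists_equiv (p := fun _ : Fin 1 => x) (q := fun _ => y)
      (Same.comp (hind x (hXA hx) y hy) fun _ => ())
    exact ⟨σ, x, hx, hσ 0⟩
  · rintro ⟨σ, x, hx, rfl⟩
    obtain ⟨φ, hφ⟩ := Dfn.mem hA (ι := Unit) ()
    have := Language.StrongHomClass.realize_formula σ φ (v := fun _ => x)
    exact (hφ _).1 (this.2 ((hφ _).2 (hXA hx)))

end Partition

end CMin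

/-! ### The proposition -/

theorem proposition8 {L : FirstOrder.Language.{u, v}} [Countable L.Symbols] (c : L.Relations 3)
    {M : Type w} [L.Structure M]
    (hM : CMin.IsCMinimal c M) (hcat : CMin.IsAlephZeroCategorical L M) :
    (∃! P : Set (Set M), CMin.IsCanonicalPartition L P) ∧
    ∀ P : Set (Set M), CMin.IsCanonicalPartition L P → ∀ A ∈ P,
      (∃ X : Set M, CMin.IsAclDefinable L X ∧
        (CMin.IsFiniteUnionOfCones hM.1 X ∨ CMin.IsAlmostThickCone hM.1 X ∨
          CMin.IsDensePrunedCone hM.1 X) ∧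
        A = CMin.orbit L X ∧
        (Countable M → A = ⋃ σ : M ≃[L] M, σ '' X)) ∧
      ∃ hA : (∅ : Set M).Definable₁ L A,
        CMin.IsCMinimal (CMin.inducedC c hA) A ∧
        CMin.IsAlephZeroCategorical (CMin.inducedLanguage L A) A ∧
        CMin.IsIndiscernible (CMin.inducedLanguage L A) A := by
  have hft := hcat.hasFiniteTypes
  refine ⟨⟨_, hft.isCanonicalPartition, fun P hP => hP.eq_classes⟩, fun P hP A hAP => ?_⟩
  obtain ⟨hA, hmax⟩ := hP.2.2 A hAP
  obtain ⟨X, hXA, hX, hacl, hform⟩ := CMin.exists_form (h := hM.1) hM hft hA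
    (Set.nonempty_iff_ne_empty.2 fun H => hP.1.1 (H ▸ hAP))
  refine ⟨⟨X, hacl, hform, CMin.eq_orbit hft hA hmax.1 hXA hX hacl,
    fun _ => CMin.eq_iUnion_image hft hA hmax.1 hXA hX⟩, hA,
    CMin.isCMinimal_induced hM hft hA hmax.1, (hft.induced hA).isAlephZeroCategorical,
    fun a _ b _ => CMin.same_induced hA (hmax.1 a a.2 b b.2)⟩
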